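/- Let $\wp$ be the Weierstrass function with periods $(2\omega_1,2\omega_3)$, where $\omega_1,\omega_3\in\mathbb{C}$ are linearly independent over $\mathbb{R}$; let $\Lambda=2\omega_1\mathbb{Z}\oplus2\omega_3\mathbb{Z}$, $\omega_0=0$ and $\omega_2=-\omega_1-\omega_3$. A meromorphic function $q$ on $\mathbb{C}$ is called \emph{algebro-geometric finite-gap} if there are $g\ge 0$ and meromorphic functions $b_0,\dots,b_{2g-1}$ on $\mathbb{C}$, holomorphic wherever $q$ is, such that the operator $\left(\frac{d}{dx}\right)^{2g+1}+\sum_{j=0}^{2g-1}b_j(x)\left(\frac{d}{dx}\right)^{2g-1-j}$ commutes with $-\frac{d^2}{dx^2}+q(x)$. Let $M,l_0,l_1,l_2,l_3\in\mathbb{Z}_{\ge0}$ and let $\delta_1,\dots,\delta_M\in\mathbb{C}$ satisfy $\delta_j\not\equiv\omega_i \pmod\Lambda$ for $0\le i\le 3$, $1\le j\le M$; $\delta_j\pm\delta_{j'}\not\equiv0\pmod\Lambda$ for $1\le j<j'\le M$; and $$2\sum_{j'\ne j}\bigl(\wp'(\delta_j-\delta_{j'})+\wp'(\delta_j+\delta_{j'})\bigr)+\sum_{i=0}^3\bigl(l_i+\tfrac12\bigr)^2\wp'(\delta_j+\omega_i)=0\qquad(j=1,\dots,M).$$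 Then the potential $$v(x)=\sum_{i=0}^3l_i(l_i+1)\wp(x+\omega_i)+2\sum_{i'=1}^M\bigl(\wp(x-\delta_{i'})+\wp(x+\delta_{i'})\bigr)$$ is algebro-geometric finite-gap. More explicitly, there are polynomials $c(E)$, $b^{(i)}_j(E)$ ($0\le i\le3$, $0\le j<l_i$) and $d^{(i')}(E)$ ($1\le i'\le M$) in $\mathbb{C}[E]$ without a common divisor of positive degree, with $c$ monic of degree $g$ and all others of degree less than $g$, such that the $\Lambda$-periodic function $$\Xi(x,E)=c(E)+\sum_{i=0}^3\sum_{j=0}^{l_i-1}b^{(i)}_j(E)\,\wp(x+\omega_i)^{l_i-j}+\sum_{i'=1}^Md^{(i')}(E)\bigl(\wp(x+\delta_{i'})+\wp(x-\delta_{i'})\bigr)$$ satisfies $\Xi'''-4(v-E)\Xi'-2v'\Xi=0$ (derivatives in $x$) for every $E\in\mathbb{C}$, and such that, writing $\Xi(x,E)=\sum_{i=0}^g a_{g-i}(x)E^i$ and $H=-\frac{d^2}{dx^2}+v(x)$, the operator $$(-1)^g\sum_{j=0}^g\Bigl(a_j(x)\frac{d}{dx}-\frac12a_j'(x)\Bigr)H^{g-j}$$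 is of the form $\left(\frac{d}{dx}\right)^{2g+1}+\sum_{j=0}^{2g-1}B_j(x)\left(\frac{d}{dx}\right)^{2g-1-j}$, with $B_j$ meromorphic on $\mathbb{C}$ and holomorphic wherever $v$ is, and commutes with $H$. -/

import Mathlib

open Polynomial

noncomputable section

namespace FiniteGap

/-! ### Algebro-geometric finite-gap potentials -/

/-- The Schrödinger operator `H = -d²/dx² + q(x)`. -/
def schrodinger (q : ℂ → ℂ) (f : ℂ → ℂ) (x : ℂ) : ℂ :=
  -iteratedDeriv 2 f x + q x * f x

/-- The monic odd-order operator
`(d/dx)^(2g+1) + ∑_{j=0}^{2g-1} b_j(x) (d/dx)^(2g-1-j)`. -/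
def oddOperator (g : ℕ) (b : Fin (2 * g) → ℂ → ℂ) (f : ℂ → ℂ) (x : ℂ) : ℂ :=
  iteratedDeriv (2 * g + 1) f x +
    ∑ j : Fin (2 * g), b j x * iteratedDeriv (2 * g - 1 - (j : ℕ)) f x

/-- The monic operator of order `2g+1` with coefficients `b` (meromorphic, and holomorphic wherever
`q` is) commutes with `-d²/dx² + q`. The commutator is a differential operator with meromorphic
coefficients; it vanishes when it kills every holomorphic germ at every point
at which the coefficients are holomorphic. -/
def CommutesWithSchrodinger (q : ℂ → ℂ) (g : ℕ) (b : Fin (2 * g) → ℂ → ℂ) : Prop :=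
  (∀ j, Meromorphic (b j)) ∧
  (∀ j x, AnalyticAt ℂ q x → AnalyticAt ℂ (b j) x) ∧
  ∀ (f : ℂ → ℂ) (x : ℂ), AnalyticAt ℂ q x → AnalyticAt ℂ f x →
    oddOperator g b (schrodinger q f) x = schrodinger q (oddOperator g b f) x

/-- A meromorphic potential `q` is algebro-geometric finite-gap if `-d²/dx² + q` commutes with a
monic odd-order differential operator. -/
def IsAlgebroGeometricFiniteGap (q : ℂ → ℂ) : Prop :=
  Meromorphic q ∧ ∃ (g : ℕ) (b : Fin (2 * g) → ℂ → ℂ), CommutesWithSchrodinger q g b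

/-! ### The potential -/

/-- With `(L.ω₁, L.ω₂) = (2ω₁, 2ω₃)`, the points `ω₀ = 0`, `ω₁`, `ω₂ = -ω₁ - ω₃`, `ω₃`. -/
def halfPeriod (L : PeriodPair) : Fin 4 → ℂ :=
  ![0, L.ω₁ / 2, -(L.ω₁ / 2) - L.ω₂ / 2, L.ω₂ / 2]

/-- `v(x) = ∑_i l_i(l_i+1) ℘(x+ω_i) + 2 ∑_{i'} (℘(x-δ_{i'}) + ℘(x+δ_{i'}))`. -/
def potential (L : PeriodPair) (l : Fin 4 → ℕ) {M : ℕ} (δ : Fin M → ℂ) (x : ℂ) : ℂ :=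
  ∑ i : Fin 4, (l i : ℂ) * ((l i : ℂ) + 1) * L.weierstrassP (x + halfPeriod L i) +
    2 * ∑ i' : Fin M, (L.weierstrassP (x - δ i') + L.weierstrassP (x + δ i'))

/-! ### The doubly periodic solution `Ξ(x,E)` and the operator built from it -/

/-- `Ξ(x,E) = c(E) + ∑_i ∑_{j<l_i} b^{(i)}_j(E) ℘(x+ω_i)^{l_i-j}
+ ∑_{i'} d^{(i')}(E) (℘(x+δ_{i'}) + ℘(x-δ_{i'}))`, as a polynomial in `E` for each `x`. -/
def xi (L : PeriodPair) (l : Fin 4 → ℕ) {M : ℕ} (δ : Fin M → ℂ)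
    (c : ℂ[X]) (b : (i : Fin 4) → Fin (l i) → ℂ[X]) (d : Fin M → ℂ[X]) (x : ℂ) : ℂ[X] :=
  c + ∑ i : Fin 4, ∑ j : Fin (l i),
      C (L.weierstrassP (x + halfPeriod L i) ^ (l i - (j : ℕ))) * b i j +
    ∑ i' : Fin M, C (L.weierstrassP (x + δ i') + L.weierstrassP (x - δ i')) * d i'

/-- The coefficients `c, b, d` make `Ξ` the normalized doubly periodic solution of
`Ξ''' - 4 (v - E) Ξ' - 2 v' Ξ = 0`. -/
structure IsXi (L : PeriodPair) (l : Fin 4 → ℕ) {M : ℕ} (δ : Fin M → ℂ)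
    (c : ℂ[X]) (b : (i : Fin 4) → Fin (l i) → ℂ[X]) (d : Fin M → ℂ[X]) : Prop where
  monic : c.Monic
  degree_b : ∀ i j, (b i j).degree < c.degree
  degree_d : ∀ i', (d i').degree < c.degree
  coprime : ∀ p : ℂ[X], p ∣ c → (∀ i j, p ∣ b i j) → (∀ i', p ∣ d i') → IsUnit p
  periodic : ∀ x, ∀ w ∈ L.lattice, xi L l δ c b d (x + w) = xi L l δ c b d x
  ode : ∀ E x : ℂ, AnalyticAt ℂ (potential L l δ) x →
    iteratedDeriv 3 (fun y => (xi L l δ c b d y).eval E) x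
      - 4 * (potential L l δ x - E) * deriv (fun y => (xi L l δ c b d y).eval E) x
      - 2 * deriv (potential L l δ) x * (xi L l δ c b d x).eval E = 0

/-- For `P(x) = ∑_{i=0}^g a_{g-i}(x) E^i`, the operator
`∑_{j=0}^g (a_j(x) d/dx - a_j'(x)/2) H^{g-j}` with `H = -d²/dx² + q(x)`. -/
def operatorOf (q : ℂ → ℂ) (g : ℕ) (P : ℂ → ℂ[X]) (f : ℂ → ℂ) (x : ℂ) : ℂ :=
  ∑ j ∈ Finset.range (g + 1),
    ((P x).coeff (g - j) * deriv ((schrodinger q)^[g - j] f) x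
      - 1 / 2 * deriv (fun y => (P y).coeff (g - j)) x * (schrodinger q)^[g - j] f x)

end FiniteGap

end

/-! Write `T f = f''' - 4 v f' - 2 v' f`. The equation for `Ξ`, multiplied by `Ξ`, is the
`x`-derivative of `Ξ Ξ'' - Ξ'² / 2 - 2 (v - E) Ξ² = 2 E`. Solving the latter by `Ξ = ∑ a_n E⁻ⁿ` with
`a_0 = 1` gives each `a_n` as a differential polynomial in `v`, with no integration (`formalCoeff`).
Hence every `a_n` is even, `Λ`-periodic and regular wherever `v` is, and differentiating gives
`a_{n+1}' = -T a_n / 4` (`deriv_formalCoeff_succ`).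

The recursion keeps the pole orders bounded independently of `n`. At a point congruent to `ω_i` the
number `2 l_i` is an exponent of `T`, so a pole of order `2 l_i` grows to order at most `2 l_i + 2`;
integration lowers this by one and evenness by one more (`poleLE_formalCoeff_half`). At `δ_j` the
potential is `2 (x - δ_j)⁻² + h`. The equation assumed for `δ_j` says exactly that `h'(δ_j) = 0`,
once the duplication formula for `℘'` has absorbed the terms `1/4` of `(l_i + 1/2)²`. That condition
preserves the shape `α (x - δ_j)⁻² + O(1)` (`doublePole_formalCoeff_delta`).

By Liouville all `a_n` then lie in the finite-dimensional span of the functions appearing in `Ξ`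
(`mem_span_basisFun`), so there is a relation `∑ p_m a_m = 0` with `p` monic. The polynomial part of
`E⁻¹ p(E) ∑ a_n E⁻ⁿ` solves the equation by telescoping (`exists_polySolution`), and dividing out
common factors gives the required `Ξ`. Finally, the coefficients of the equation in powers of `E`
are the relations under which the commutator of `∑ (e_i d/dx - e_i'/2) H^i` with `H` telescopes to
zero (`hierarchyOperator_comm`). -/

namespace FiniteGap

open Filter Topology

/-! ### Pole orders -/

/-- `f` has at most a pole of order `k` at `p`. -/
def PoleLE (k : ℕ) (f : ℂ → ℂ) (p : ℂ) : Prop :=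
  ∃ G : ℂ → ℂ, AnalyticAt ℂ G p ∧ ∀ᶠ x in 𝓝[≠] p, (x - p) ^ k * f x = G x

theorem poleLE_zero_of_analyticAt {f : ℂ → ℂ} {p : ℂ} (hf : AnalyticAt ℂ f p) : PoleLE 0 f p :=
  ⟨f, hf, by simp⟩

theorem PoleLE.mono {k m : ℕ} {f : ℂ → ℂ} {p : ℂ} (h : PoleLE k f p) (hkm : k ≤ m) :
    PoleLE m f p := by
  obtain ⟨G, hG, hfG⟩ := h
  refine ⟨fun x => (x - p) ^ (m - k) * G x, by fun_prop, ?_⟩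
  filter_upwards [hfG] with x hx
  rw [← hx, ← mul_assoc, ← pow_add, Nat.sub_add_cancel hkm]

theorem PoleLE.congr {k : ℕ} {f g : ℂ → ℂ} {p : ℂ} (h : PoleLE k f p) (hfg : f =ᶠ[𝓝[≠] p] g) :
    PoleLE k g p := by
  obtain ⟨G, hG, hfG⟩ := h
  refine ⟨G, hG, ?_⟩
  filter_upwards [hfG, hfg] with x hx h
  rw [← h, hx]

theorem PoleLE.add {k : ℕ} {f g : ℂ → ℂ} {p : ℂ} (hf : PoleLE k f p) (hg : PoleLE k g p) :
    PoleLE k (fun x => f x + g x) p := by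
  obtain ⟨F, hF, hfF⟩ := hf
  obtain ⟨G, hG, hgG⟩ := hg
  refine ⟨fun x => F x + G x, by fun_prop, ?_⟩
  filter_upwards [hfF, hgG] with x h1 h2
  rw [mul_add, h1, h2]

theorem PoleLE.const_mul {k : ℕ} {f : ℂ → ℂ} {p : ℂ} (hf : PoleLE k f p) (c : ℂ) :
    PoleLE k (fun x => c * f x) p := by
  obtain ⟨F, hF, hfF⟩ := hf
  refine ⟨fun x => c * F x, by fun_prop, ?_⟩
  filter_upwards [hfF] with x h1
  rw [← h1]; ring

theorem PoleLE.sub {k : ℕ} {f g : ℂ → ℂ} {p : ℂ} (hf : PoleLE k f p) (hg : PoleLE k g p) :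
    PoleLE k (fun x => f x - g x) p :=
  (hf.add (hg.const_mul (-1))).congr (.of_forall fun x => by ring)

theorem PoleLE.meromorphicAt {k : ℕ} {f : ℂ → ℂ} {p : ℂ} (hf : PoleLE k f p) :
    MeromorphicAt f p := by
  obtain ⟨G, hG, h⟩ := hf
  have h2 : MeromorphicAt (fun x => ((x - p) ^ k)⁻¹ * G x) p := by fun_prop
  refine h2.congr ?_
  filter_upwards [h, self_mem_nhdsWithin] with x hx hxp
  have : (x - p) ^ k ≠ 0 := pow_ne_zero _ (sub_ne_zero.2 hxp)
  rw [← hx]; field_simp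

theorem poleLE_iff {k : ℕ} {f : ℂ → ℂ} {p : ℂ} :
    PoleLE k f p ↔ MeromorphicAt f p ∧ ((-k : ℤ) : WithTop ℤ) ≤ meromorphicOrderAt f p := by
  have key : ∀ hf : MeromorphicAt f p, meromorphicOrderAt (fun x => (x - p) ^ k * f x) p =
      ((k : ℤ) : WithTop ℤ) + meromorphicOrderAt f p := fun hf => by
    have h1 := fun_meromorphicOrderAt_mul (f := fun x => (x - p) ^ k) (g := f) (x := p)
      (by fun_prop) hf
    rw [h1, fun_meromorphicOrderAt_pow_id_sub_const]
    norm_cast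
  constructor
  · intro h
    have hm := h.meromorphicAt
    refine ⟨hm, ?_⟩
    obtain ⟨G, hG, hfG⟩ := h
    have h0 : 0 ≤ meromorphicOrderAt (fun x => (x - p) ^ k * f x) p := by
      rw [meromorphicOrderAt_congr (f₂ := G) hfG]; exact hG.meromorphicOrderAt_nonneg
    rw [key hm] at h0
    cases h : meromorphicOrderAt f p with
    | top => simp
    | coe n => rw [h] at h0; norm_cast at h0 ⊢; omega
  · rintro ⟨hm, h⟩
    have h0 : 0 ≤ meromorphicOrderAt (fun x => (x - p) ^ k * f x) p := by
      rw [key hm]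
      cases h' : meromorphicOrderAt f p with
      | top => simp
      | coe n => rw [h'] at h; norm_cast at h ⊢; omega
    have hm2 : MeromorphicAt (fun x => (x - p) ^ k * f x) p := by fun_prop
    exact hm2.meromorphicOrderAt_nonneg_iff.1 h0

/-- Differentiation lowers a negative order by exactly one. For `k = 0` this contains the fact that
the derivative of a meromorphic function has no residue. -/
theorem PoleLE.of_deriv {k : ℕ} {f : ℂ → ℂ} {p : ℂ} (hf : MeromorphicAt f p)
    (h : PoleLE (k + 1) (deriv f) p) : PoleLE k f p := by
  rw [poleLE_iff] at h ⊢
  refine ⟨hf, ?_⟩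
  cases ho : meromorphicOrderAt f p with
  | top => simp
  | coe n =>
    by_cases hn : 0 ≤ n
    · norm_cast; omega
    have h2 := h.2
    rw [meromorphicOrderAt_deriv_eq_sub_one (n := n) (by exact_mod_cast (by omega : n ≠ 0)) ho] at h2
    norm_cast at h2 ⊢
    omega

theorem eq_of_eventuallyEq_nhdsNE {F G : ℂ → ℂ} {p : ℂ} (hF : ContinuousAt F p)
    (hG : ContinuousAt G p) (h : ∀ᶠ x in 𝓝[≠] p, F x = G x) : F p = G p :=
  ((hF.eventuallyEq_nhds_iff_eventuallyEq_nhdsNE hG).1 h).eq_of_nhds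

theorem exists_eq_mul_of_analyticAt {F : ℂ → ℂ} {p : ℂ} (hF : AnalyticAt ℂ F p) (h0 : F p = 0) :
    ∃ G : ℂ → ℂ, AnalyticAt ℂ G p ∧ ∀ x, F x = (x - p) * G x := by
  refine ⟨dslope F p, ?_, fun x => ?_⟩
  · have hc : ContinuousAt (dslope F p) p := continuousAt_dslope_same.2 hF.differentiableAt
    refine MeromorphicAt.analyticAt ?_ hc
    have : MeromorphicAt (fun x => (x - p)⁻¹ * F x) p := by
      have := hF.meromorphicAt
      fun_prop
    refine this.congr ?_
    filter_upwards [self_mem_nhdsWithin] with x hx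
    rw [dslope_of_ne _ hx, slope_def_field, h0]
    field_simp
    simp
  · have := sub_smul_dslope F p x
    simp only [smul_eq_mul, h0, sub_zero] at this
    exact this.symm

theorem PoleLE.of_pole_succ {k : ℕ} {f G : ℂ → ℂ} {p : ℂ} (hG : AnalyticAt ℂ G p)
    (h : ∀ᶠ x in 𝓝[≠] p, (x - p) ^ (k + 1) * f x = G x) (h0 : G p = 0) : PoleLE k f p := by
  obtain ⟨G1, hG1, hGG⟩ := exists_eq_mul_of_analyticAt hG h0
  refine ⟨G1, hG1, ?_⟩
  filter_upwards [h, self_mem_nhdsWithin] with x hx hxp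
  have : x - p ≠ 0 := sub_ne_zero.2 hxp
  rw [hGG, pow_succ] at hx
  apply mul_left_cancel₀ this
  rw [← hx]; ring

/-- `f` is even about `p`. -/
def EvenAbout (p : ℂ) (f : ℂ → ℂ) : Prop := ∀ x, f (2 * p - x) = f x

theorem tendsto_reflection (p : ℂ) : Tendsto (fun x : ℂ => 2 * p - x) (𝓝[≠] p) (𝓝[≠] p) := by
  refine tendsto_nhdsWithin_iff.2 ⟨?_, ?_⟩
  · have : ContinuousAt (fun x : ℂ => 2 * p - x) p := by fun_prop
    have h := this.tendsto
    rw [show 2 * p - p = p by ring] at h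
    exact h.mono_left nhdsWithin_le_nhds
  · filter_upwards [self_mem_nhdsWithin] with x hx h
    exact hx (by have : 2 * p - x = p := h
                 show x = p
                 linear_combination -this)

/-- Multiplying an even function by an odd power of `x - p` gives a function odd about `p`; its
analytic extension vanishes at `p`. -/
theorem PoleLE.of_evenAbout {k : ℕ} {f : ℂ → ℂ} {p : ℂ} (he : EvenAbout p f)
    (h : PoleLE (2 * k + 1) f p) : PoleLE (2 * k) f p := by
  obtain ⟨G, hG, hfG⟩ := h
  have h1 : ∀ᶠ x in 𝓝[≠] p, G (2 * p - x) = - G x := by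
    filter_upwards [hfG, (tendsto_reflection p).eventually hfG] with x h1 h2
    rw [← h1, ← h2, he, show 2 * p - x - p = -(x - p) by ring, Odd.neg_pow ⟨k, rfl⟩]
    ring
  have hGc := hG.continuousAt
  have h2 : G (2 * p - p) = - G p := by
    refine eq_of_eventuallyEq_nhdsNE (F := fun x => G (2 * p - x))
      (G := fun x => - G x) ?_ hGc.neg h1
    have h3 : ContinuousAt G (2 * p - p) := by rwa [show 2 * p - p = p by ring]
    exact ContinuousAt.comp (f := fun x => 2 * p - x) h3 (by fun_prop)
  rw [show 2 * p - p = p by ring] at h2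
  refine PoleLE.of_pole_succ hG hfG ?_
  have : 2 * G p = 0 := by linear_combination h2
  simpa using this

/-! ### The third order operator -/

/-- `f ↦ f''' - 4 v f' - 2 v' f`. -/
noncomputable def thirdOrder (v f : ℂ → ℂ) (x : ℂ) : ℂ :=
  deriv (deriv (deriv f)) x - 4 * v x * deriv f x - 2 * deriv v x * f x

theorem deriv_pole_witness {k : ℕ} {f G : ℂ → ℂ} {p : ℂ} (hG : AnalyticAt ℂ G p)
    (h : ∀ᶠ x in 𝓝[≠] p, (x - p) ^ k * f x = G x) :
    ∀ᶠ x in 𝓝[≠] p, (x - p) ^ (k + 1) * deriv f x = (x - p) * deriv G x - k * G x := by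
  have h1 : f =ᶠ[𝓝[≠] p] fun x => ((x - p) ^ k)⁻¹ * G x := by
    filter_upwards [h, self_mem_nhdsWithin] with x hx hxp
    have : (x - p) ^ k ≠ 0 := pow_ne_zero _ (sub_ne_zero.2 hxp)
    rw [← hx]; field_simp
  filter_upwards [h1.nhdsNE_deriv, self_mem_nhdsWithin,
    hG.eventually_analyticAt.filter_mono nhdsWithin_le_nhds] with x hx hxp hGx
  have hne : x - p ≠ 0 := sub_ne_zero.2 hxp
  have hd : HasDerivAt (fun x => ((x - p) ^ k)⁻¹ * G x)
      (-(k * (x - p) ^ (k - 1) * 1) / ((x - p) ^ k) ^ 2 * G x + ((x - p) ^ k)⁻¹ * deriv G x) x :=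
    ((((hasDerivAt_id x).sub_const p).pow k).inv (pow_ne_zero _ hne)).mul
      hGx.differentiableAt.hasDerivAt
  rw [hx, hd.deriv]
  rcases k with _ | k
  · simp
  · simp only [Nat.add_sub_cancel]
    push_cast
    field_simp
    ring

/-- Keeps track of the leading Laurent coefficient, which differentiation multiplies by `-k`, so
that cancellations of leading terms can be read off at `p`. -/
theorem exists_deriv_pole_witness {k : ℕ} {f G : ℂ → ℂ} {p : ℂ} (hG : AnalyticAt ℂ G p)
    (h : ∀ᶠ x in 𝓝[≠] p, (x - p) ^ k * f x = G x) :
    ∃ F : ℂ → ℂ, AnalyticAt ℂ F p ∧ F p = -k * G p ∧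
      ∀ᶠ x in 𝓝[≠] p, (x - p) ^ (k + 1) * deriv f x = F x :=
  ⟨_, by have := hG.deriv; fun_prop, by simp, deriv_pole_witness hG h⟩

/-- On `(x - p)⁻ᵏ` the leading coefficient of the operator is `-(k + 1)(k - 2l)(k + 2l + 2)`, which
vanishes at `k = 2l`. So the pole order grows by at most two instead of three. -/
theorem PoleLE.thirdOrder_of_even_pole {l : ℕ} {v h f : ℂ → ℂ} {p : ℂ} (hh : AnalyticAt ℂ h p)
    (hv : ∀ᶠ x in 𝓝[≠] p, v x = l * (l + 1) * ((x - p) ^ 2)⁻¹ + h x)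
    (hf : PoleLE (2 * l) f p) : PoleLE (2 * l + 2) (thirdOrder v f) p := by
  obtain ⟨G, hG, hfG⟩ := hf
  have hv2 : ∀ᶠ x in 𝓝[≠] p, (x - p) ^ 2 * v x = (fun x => l * (l + 1) + (x - p) ^ 2 * h x) x := by
    filter_upwards [hv, self_mem_nhdsWithin] with x hx hxp
    have : x - p ≠ 0 := sub_ne_zero.2 hxp
    rw [hx]; field_simp
  obtain ⟨V, hV, hVp, hv3⟩ := exists_deriv_pole_witness (by fun_prop) hv2
  obtain ⟨F1, hF1, hF1p, hf1⟩ := exists_deriv_pole_witness hG hfG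
  obtain ⟨F2, hF2, hF2p, hf2⟩ := exists_deriv_pole_witness hF1 hf1
  obtain ⟨F3, hF3, hF3p, hf3⟩ := exists_deriv_pole_witness hF2 hf2
  refine PoleLE.of_pole_succ
    (G := fun x => F3 x - 4 * (l * (l + 1) + (x - p) ^ 2 * h x) * F1 x - 2 * V x * G x)
    (by fun_prop) ?_ ?_
  · filter_upwards [hfG, hv2, hv3, hf1, hf3] with x h0 h1 h2 h3 h4
    rw [← h0, ← h2, ← h3, ← h4, ← h1, thirdOrder]
    ring
  · simp only [hF3p, hF2p, hF1p, hVp]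
    push_cast
    ring

/-- `f = α (x-p)⁻² + O(1)` at `p`. -/
def DoublePole (f : ℂ → ℂ) (p : ℂ) : Prop :=
  ∃ (α : ℂ) (g : ℂ → ℂ), AnalyticAt ℂ g p ∧ ∀ᶠ x in 𝓝[≠] p, f x = α * ((x - p) ^ 2)⁻¹ + g x

theorem deriv_laurent {n : ℕ} {α : ℂ} {f g : ℂ → ℂ} {p : ℂ} (hg : AnalyticAt ℂ g p)
    (h : ∀ᶠ x in 𝓝[≠] p, f x = α * ((x - p) ^ (n + 1))⁻¹ + g x) :
    ∀ᶠ x in 𝓝[≠] p, deriv f x = (-(n + 1 : ℕ) * α) * ((x - p) ^ (n + 2))⁻¹ + deriv g x := by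
  have h' : f =ᶠ[𝓝[≠] p] fun x => α * ((x - p) ^ (n + 1))⁻¹ + g x := h
  filter_upwards [h'.nhdsNE_deriv, self_mem_nhdsWithin,
    hg.eventually_analyticAt.filter_mono nhdsWithin_le_nhds] with x hx hxp hgx
  have hne : x - p ≠ 0 := sub_ne_zero.2 hxp
  have hd : HasDerivAt (fun x => α * ((x - p) ^ (n + 1))⁻¹ + g x)
      (α * (-((n + 1 : ℕ) * (x - p) ^ n * 1) / ((x - p) ^ (n + 1)) ^ 2) + deriv g x) x :=
    (((((hasDerivAt_id x).sub_const p).pow (n + 1)).inv (pow_ne_zero _ hne)).const_mul α).add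
      hgx.differentiableAt.hasDerivAt
  rw [hx, hd.deriv]
  field_simp
  ring

/-- With `t = x - p`, the `t⁻⁵` terms cancel (`-24 + 16 + 8 = 0`) and the coefficient of `t⁻²` in
`thirdOrder v f` is `6 α h'(p) = 0`. Hence `b'` has a `t⁻³` term and at most a simple pole besides,
and `b` gets no `t⁻¹` term. -/
theorem DoublePole.of_deriv_eq_thirdOrder {v h f b : ℂ → ℂ} {p c : ℂ} (hh : AnalyticAt ℂ h p)
    (hh0 : deriv h p = 0)
    (hv : ∀ᶠ x in 𝓝[≠] p, v x = 2 * ((x - p) ^ 2)⁻¹ + h x)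
    (hf : DoublePole f p) (hb : MeromorphicAt b p)
    (hbf : ∀ᶠ x in 𝓝[≠] p, deriv b x = c * thirdOrder v f x) : DoublePole b p := by
  obtain ⟨α, g, hg, hf⟩ := hf
  have hf1 := deriv_laurent hg hf
  have hf2 := deriv_laurent hg.deriv hf1
  have hf3 := deriv_laurent hg.deriv.deriv hf2
  have hv1 := deriv_laurent hh hv
  obtain ⟨u, hu, hu'⟩ := exists_eq_mul_of_analyticAt
    (F := fun x => 8 * (α * h x + g x) - 8 * (α * h p + g p)) (p := p) (by fun_prop) (by simp)
  -- `κ` is the coefficient of `(x - p)⁻³` in `thirdOrder v f`; `u` carries the remainder, which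
  -- contributes to the coefficient of `(x - p)⁻²`.
  set κ : ℂ := 8 * (α * h p + g p) with hκ
  have hup : u p = 8 * deriv g p := by
    have h1 : HasDerivAt (fun x => 8 * (α * h x + g x) - κ)
        (8 * (α * deriv h p + deriv g p)) p :=
      (((hh.differentiableAt.hasDerivAt.const_mul α).add
        hg.differentiableAt.hasDerivAt).const_mul 8).sub_const κ
    have h2 : HasDerivAt (fun x => (x - p) * u x) (1 * u p + (p - p) * deriv u p) p :=
      ((hasDerivAt_id p).sub_const p).mul hu.differentiableAt.hasDerivAt
    have h3 : (fun x => 8 * (α * h x + g x) - κ) = fun x => (x - p) * u x := funext hu'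
    rw [h3] at h1
    have := h2.unique h1
    rw [hh0] at this
    linear_combination this
  have hkey : PoleLE 1 (fun x => deriv b x - c * κ * ((x - p) ^ 3)⁻¹) p := by
    have hg1 := hg.deriv
    have hg2 := hg1.deriv
    have hg3 := hg2.deriv
    have hh1 := hh.deriv
    refine PoleLE.of_pole_succ (G := fun x => c * (u x - 8 * deriv g x
        - 2 * α * deriv h x + (x - p) ^ 2 * (deriv (deriv (deriv g)) x
        - 4 * h x * deriv g x - 2 * deriv h x * g x))) (by fun_prop) ?_ ?_
    · filter_upwards [hf, hf1, hf3, hv, hv1, hbf, self_mem_nhdsWithin] with x h0 h1 h3 h4 h5 h6 hxp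
      have hne : x - p ≠ 0 := sub_ne_zero.2 hxp
      rw [h6, thirdOrder, h0, h1, h3, h4, h5]
      have := hu' x
      push_cast
      field_simp
      linear_combination c * (x - p) ^ 2 * this
    · simp only [hup, hh0]; ring
  have hq : ∀ᶠ x in 𝓝[≠] p, (fun x => ((x - p) ^ 2)⁻¹) x = 1 * ((x - p) ^ (1 + 1))⁻¹ +
      (fun _ => (0 : ℂ)) x := by simp
  have hq' := deriv_laurent analyticAt_const hq
  -- Adding `(c κ / 2)(x - p)⁻²` removes the `(x - p)⁻³` term from the derivative. What is left has
  -- a derivative with at most a simple pole, hence is regular.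
  have hbm : MeromorphicAt (fun x => b x + c * κ / 2 * ((x - p) ^ 2)⁻¹) p := by fun_prop
  have hfin : PoleLE 0 (fun x => b x + c * κ / 2 * ((x - p) ^ 2)⁻¹) p := by
    refine PoleLE.of_deriv hbm (hkey.congr ?_)
    filter_upwards [hq', hb.eventually_analyticAt, self_mem_nhdsWithin] with x h1 h2 hxp
    have hne : x - p ≠ 0 := sub_ne_zero.2 hxp
    have hdq : DifferentiableAt ℂ (fun x : ℂ => ((x - p) ^ 2)⁻¹) x := by
      fun_prop (disch := exact pow_ne_zero _ hne)
    rw [deriv_fun_add h2.differentiableAt (hdq.const_mul _), deriv_const_mul _ hdq, h1]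
    simp
    ring
  obtain ⟨G, hG, hGb⟩ := hfin
  refine ⟨-(c * κ / 2), G, hG, ?_⟩
  filter_upwards [hGb] with x hx
  rw [← hx]; ring

/-! ### The formal solution at `E = ∞` -/

/-- The coefficients `a_n` of the formal solution `∑ a_n E⁻ⁿ`, `a_0 = 1`, of
`Ξ Ξ'' - Ξ'² / 2 - 2 (v - E) Ξ² = 2 E`. -/
noncomputable def formalCoeff (v : ℂ → ℂ) : ℕ → ℂ → ℂ
  | 0 => fun _ => 1
  | n + 1 => fun x => -(1 / 4) *
      (2 * ∑ k : Fin n, formalCoeff v (k + 1) x * formalCoeff v (n - k) x +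
        ∑ k : Fin (n + 1), (formalCoeff v k x * deriv (deriv (formalCoeff v (n - k))) x
          - 1 / 2 * (deriv (formalCoeff v k) x * deriv (formalCoeff v (n - k)) x)
          - 2 * v x * (formalCoeff v k x * formalCoeff v (n - k) x)))
  decreasing_by all_goals omega

theorem formalCoeff_zero (v : ℂ → ℂ) : formalCoeff v 0 = fun _ => 1 := by
  rw [formalCoeff]

theorem formalCoeff_succ (v : ℂ → ℂ) (n : ℕ) : formalCoeff v (n + 1) = fun x => -(1 / 4) *
      (2 * ∑ k : Fin n, formalCoeff v (k + 1) x * formalCoeff v (n - k) x +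
        ∑ k : Fin (n + 1), (formalCoeff v k x * deriv (deriv (formalCoeff v (n - k))) x
          - 1 / 2 * (deriv (formalCoeff v k) x * deriv (formalCoeff v (n - k)) x)
          - 2 * v x * (formalCoeff v k x * formalCoeff v (n - k) x))) := by
  rw [formalCoeff]

theorem analyticAt_formalCoeff {v : ℂ → ℂ} {x : ℂ} (hv : AnalyticAt ℂ v x) (n : ℕ) :
    AnalyticAt ℂ (formalCoeff v n) x := by
  induction n using Nat.strong_induction_on with
  | _ n ih =>
    rcases n with _ | n
    · rw [formalCoeff_zero]; exact analyticAt_const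
    rw [formalCoeff_succ]
    refine analyticAt_const.mul ((analyticAt_const.mul
      (Finset.analyticAt_fun_sum _ fun k _ => ?_)).add (Finset.analyticAt_fun_sum _ fun k _ => ?_))
    · exact (ih _ (by omega)).mul (ih _ (by omega))
    · have h1 := ih k (by omega)
      have h2 := ih (n - k) (by omega)
      have h3 := h1.deriv
      have h4 := h2.deriv
      have h5 := h4.deriv
      fun_prop

theorem meromorphic_formalCoeff {v : ℂ → ℂ} (hv : Meromorphic v) (n : ℕ) :
    Meromorphic (formalCoeff v n) := by
  induction n using Nat.strong_induction_on with
  | _ n ih =>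
    rcases n with _ | n
    · rw [formalCoeff_zero]; exact Meromorphic.const _
    rw [formalCoeff_succ]
    intro x
    refine (MeromorphicAt.const _ x).mul (((MeromorphicAt.const _ x).mul
      (MeromorphicAt.fun_sum fun k _ => ?_)).add (MeromorphicAt.fun_sum fun k _ => ?_))
    · exact (ih _ (by omega) x).mul (ih _ (by omega) x)
    · have h0 := hv x
      have h1 := ih k (by omega) x
      have h2 := ih (n - k) (by omega) x
      have h3 := h1.deriv
      have h4 := h2.deriv
      have h5 := h4.deriv
      fun_prop

/-! ### Invariance of the formal coefficients under `x ↦ ±x + t` -/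

theorem deriv_comp_affine (f : ℂ → ℂ) (s t x : ℂ) :
    deriv (fun y => f (s * y + t)) x = s * deriv f (s * x + t) := by
  have h1 := deriv_comp_mul_left s (fun z => f (z + t)) x
  rw [h1, deriv_comp_add_const, smul_eq_mul]

theorem deriv_of_comp_affine {f : ℂ → ℂ} {s t e : ℂ} (hs : s * s = 1)
    (h : ∀ x, f (s * x + t) = e * f x) (x : ℂ) :
    deriv f (s * x + t) = s * e * deriv f x := by
  have h1 := deriv_comp_affine f s t x
  rw [funext h, deriv_const_mul_field] at h1
  linear_combination (-s) * h1 - deriv f (s * x + t) * hs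

/-- The condition `s * s = 1` treats translations and reflections together. Each monomial of the
recursion contains an even number of derivatives, so the factors `s` cancel in pairs. -/
theorem formalCoeff_comp_affine {v : ℂ → ℂ} {s t : ℂ} (hs : s * s = 1)
    (hv : ∀ x, v (s * x + t) = v x) (n : ℕ) (x : ℂ) :
    formalCoeff v n (s * x + t) = formalCoeff v n x := by
  induction n using Nat.strong_induction_on generalizing x with
  | _ n ih =>
    rcases n with _ | n
    · rw [formalCoeff_zero]
    have hd : ∀ m < n + 1, ∀ x, deriv (formalCoeff v m) (s * x + t) =
        s * deriv (formalCoeff v m) x := fun m hm x => by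
      have := deriv_of_comp_affine (e := 1) hs (by simpa using ih m hm) x
      rwa [mul_one] at this
    have hdd : ∀ m < n + 1, ∀ x, deriv (deriv (formalCoeff v m)) (s * x + t) =
        deriv (deriv (formalCoeff v m)) x := fun m hm x => by
      have := deriv_of_comp_affine hs (hd m hm) x
      rwa [hs, one_mul] at this
    rw [formalCoeff_succ]
    simp only
    congr 2
    · congr 1
      exact Finset.sum_congr rfl fun k _ => by rw [ih _ (by omega), ih _ (by omega)]
    · refine Finset.sum_congr rfl fun k _ => ?_
      rw [ih k (by omega), ih (n - k) (by omega), hd k (by omega), hd (n - k) (by omega),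
        hdd (n - k) (by omega), hv]
      linear_combination
        (-(1 / 2) * (deriv (formalCoeff v k) x * deriv (formalCoeff v (n - k)) x)) * hs

/-- The coefficient of `E⁻ⁿ` in the quadratic identity. The two end terms `a_0 a_{n+1}` of the first
convolution contribute `4 a_{n+1}`, which is what the recursion solves for. -/
theorem formalCoeff_quadratic (v : ℂ → ℂ) (n : ℕ) (x : ℂ) :
    2 * ∑ ij ∈ Finset.HasAntidiagonal.antidiagonal (n + 1),
        formalCoeff v ij.1 x * formalCoeff v ij.2 x +
      ∑ ij ∈ Finset.HasAntidiagonal.antidiagonal n, (formalCoeff v ij.1 x * deriv (deriv (formalCoeff v ij.2)) x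
          - 1 / 2 * (deriv (formalCoeff v ij.1) x * deriv (formalCoeff v ij.2) x)
          - 2 * v x * (formalCoeff v ij.1 x * formalCoeff v ij.2 x)) = 0 := by
  have h := congrFun (formalCoeff_succ v n) x
  rw [Fin.sum_univ_eq_sum_range (fun k => formalCoeff v (k + 1) x * formalCoeff v (n - k) x) n,
    Fin.sum_univ_eq_sum_range (fun k => formalCoeff v k x * deriv (deriv (formalCoeff v (n - k))) x
      - 1 / 2 * (deriv (formalCoeff v k) x * deriv (formalCoeff v (n - k)) x)
      - 2 * v x * (formalCoeff v k x * formalCoeff v (n - k) x)) (n + 1)] at h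
  rw [Finset.Nat.sum_antidiagonal_eq_sum_range_succ_mk,
    Finset.Nat.sum_antidiagonal_eq_sum_range_succ_mk, Finset.sum_range_succ, Finset.sum_range_succ']
  simp only [Nat.add_sub_add_right, Nat.sub_zero, Nat.sub_self]
  simp only [congrFun (formalCoeff_zero v) x, one_mul, mul_one]
  linear_combination 4 * h

/-- With `X = E⁻¹`, differentiating the quadratic identity in `x` gives a product of power series
equal to zero, one factor being `∑ a_n Xⁿ`. That factor has constant term `1`, and power series over
`ℂ` form a domain, so the other factor vanishes. -/
theorem deriv_formalCoeff_succ {v : ℂ → ℂ} {x : ℂ} (hv : AnalyticAt ℂ v x) (n : ℕ) :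
    deriv (formalCoeff v (n + 1)) x = -(1 / 4) * thirdOrder v (formalCoeff v n) x := by
  set a := formalCoeff v with ha
  have h0 : ∀ n, HasDerivAt (a n) (deriv (a n) x) x := fun n =>
    (analyticAt_formalCoeff hv n).differentiableAt.hasDerivAt
  have h1 : ∀ n, HasDerivAt (deriv (a n)) (deriv (deriv (a n)) x) x := fun n =>
    (analyticAt_formalCoeff hv n).deriv.differentiableAt.hasDerivAt
  have h2 : ∀ n, HasDerivAt (deriv (deriv (a n))) (deriv (deriv (deriv (a n))) x) x := fun n =>
    (analyticAt_formalCoeff hv n).deriv.deriv.differentiableAt.hasDerivAt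
  have hvd := hv.differentiableAt.hasDerivAt
  set P0 := PowerSeries.mk fun n => a n x with hP0
  set P1 := PowerSeries.mk fun n => deriv (a n) x with hP1
  set P2 := PowerSeries.mk fun n => deriv (deriv (a n)) x with hP2
  set P3 := PowerSeries.mk fun n => deriv (deriv (deriv (a n))) x with hP3
  set c : ℂ → PowerSeries ℂ := fun z => PowerSeries.C z with hc
  have hkey : P0 * (PowerSeries.X * (P3 - c (4 * v x) * P1 - c (2 * deriv v x) * P0)
      + c 4 * P1) = 0 := by
    have e : P0 * (PowerSeries.X * (P3 - c (4 * v x) * P1 - c (2 * deriv v x) * P0) + c 4 * P1)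
        = c 2 * (P1 * P0 + P0 * P1) + PowerSeries.X * ((P1 * P2 + P0 * P3)
          - c (1 / 2) * (P2 * P1 + P1 * P2) - (c (2 * deriv v x) * (P0 * P0) +
            c (2 * v x) * (P1 * P0 + P0 * P1))) := by
      have e4 : c 4 = c 2 * 2 := by
        simp only [hc]
        rw [← map_ofNat (PowerSeries.C (R := ℂ)) 2, ← map_mul]; norm_num
      have e5 : c (4 * v x) = c (2 * v x) * 2 := by
        simp only [hc]
        rw [← map_ofNat (PowerSeries.C (R := ℂ)) 2, ← map_mul]; ring_nf
      have e6 : c (1 / 2) * 2 = 1 := by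
        simp only [hc]
        rw [← map_ofNat (PowerSeries.C (R := ℂ)) 2, ← map_mul]; norm_num
      rw [e4, e5]
      linear_combination PowerSeries.X * P1 * P2 * e6
    rw [e]
    ext m
    rcases m with _ | m
    · simp [hc, hP0, hP1, ha, formalCoeff_zero]
    have hd : HasDerivAt (fun _ : ℂ => (0 : ℂ))
        (2 * ∑ ij ∈ Finset.HasAntidiagonal.antidiagonal (m + 1), (deriv (a ij.1) x * a ij.2 x +
            a ij.1 x * deriv (a ij.2) x) +
          ∑ ij ∈ Finset.HasAntidiagonal.antidiagonal m, ((deriv (a ij.1) x * deriv (deriv (a ij.2)) x +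
            a ij.1 x * deriv (deriv (deriv (a ij.2))) x)
          - 1 / 2 * (deriv (deriv (a ij.1)) x * deriv (a ij.2) x +
              deriv (a ij.1) x * deriv (deriv (a ij.2)) x)
          - (2 * deriv v x * (a ij.1 x * a ij.2 x) +
            2 * v x * (deriv (a ij.1) x * a ij.2 x + a ij.1 x * deriv (a ij.2) x)))) x := by
      have := fun y => formalCoeff_quadratic v m y
      rw [← funext this]
      refine ((HasDerivAt.fun_sum fun ij _ => (h0 _).mul (h0 _)).const_mul 2).add
        (HasDerivAt.fun_sum fun ij _ => ?_)
      exact (((h0 _).mul (h2 _)).sub (((h1 _).mul (h1 _)).const_mul _)).sub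
        ((hvd.const_mul 2).mul ((h0 _).mul (h0 _)))
    have hz := hd.unique (hasDerivAt_const x (0 : ℂ))
    simp only [hc, map_add, map_sub, PowerSeries.coeff_C_mul, PowerSeries.coeff_succ_X_mul,
      map_zero]
    simp only [PowerSeries.coeff_mul, hP0, hP1, hP2, hP3, PowerSeries.coeff_mk]
    rw [← hz]
    simp only [Finset.sum_add_distrib, Finset.sum_sub_distrib, Finset.mul_sum, mul_add]
  have hne : P0 ≠ 0 := fun h => by
    have := congrArg (PowerSeries.coeff 0) h
    simp [hP0, ha, formalCoeff_zero] at this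
  have hz := congrArg (PowerSeries.coeff (n + 1)) ((mul_eq_zero.1 hkey).resolve_left hne)
  simp only [hc, map_add, map_sub, PowerSeries.coeff_C_mul, PowerSeries.coeff_succ_X_mul, hP0, hP1,
    hP3, PowerSeries.coeff_mk, map_zero] at hz
  rw [thirdOrder]
  linear_combination (1 / 4) * hz

/-! ### Symmetries of pole orders and Liouville's theorem -/

theorem tendsto_affine {s t p : ℂ} (hs : s * s = 1) :
    Tendsto (fun x : ℂ => s * (x - t)) (𝓝[≠] (s * p + t)) (𝓝[≠] p) := by
  refine tendsto_nhdsWithin_iff.2 ⟨?_, ?_⟩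
  · have : ContinuousAt (fun x : ℂ => s * (x - t)) (s * p + t) := by fun_prop
    have h := this.tendsto
    rw [show s * (s * p + t - t) = p by linear_combination p * hs] at h
    exact h.mono_left nhdsWithin_le_nhds
  · filter_upwards [self_mem_nhdsWithin] with x hx h
    refine hx (show x = s * p + t from ?_)
    have : s * (x - t) = p := h
    linear_combination s * this - (x - t) * hs

theorem PoleLE.comp_affine {k : ℕ} {F : ℂ → ℂ} {p s t : ℂ} (hs : s * s = 1)
    (hF : ∀ x, F (s * x + t) = F x) (h : PoleLE k F p) : PoleLE k F (s * p + t) := by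
  obtain ⟨G, hG, h⟩ := h
  refine ⟨fun x => s ^ k * G (s * (x - t)), ?_, ?_⟩
  · have h1 : AnalyticAt ℂ G (s * (s * p + t - t)) := by
      rwa [show s * (s * p + t - t) = p by linear_combination p * hs]
    exact analyticAt_const.mul (h1.comp (f := fun x => s * (x - t)) (by fun_prop))
  · filter_upwards [(tendsto_affine hs).eventually h] with x hx
    rw [← hx, ← hF (s * (x - t)), ← mul_assoc, ← mul_pow,
      show s * (s * (x - t) - p) = x - (s * p + t) by linear_combination (x - t) * hs,
      show s * (s * (x - t)) + t = x by linear_combination (x - t) * hs]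

/-- Liouville's theorem for elliptic functions. The values of `F` at removable singularities are
arbitrary, whence the restriction to points of continuity. -/
theorem exists_const_of_periodic (L : PeriodPair) {F : ℂ → ℂ} (hF : ∀ p, PoleLE 0 F p)
    (hper : ∀ x, ∀ w ∈ L.lattice, F (x + w) = F x) :
    ∃ c, ∀ x, ContinuousAt F x → F x = c := by
  choose G hG hFG using hF
  simp only [pow_zero, one_mul] at hFG
  -- The diagonal `y ↦ G y y` is `F` with its removable singularities filled in; near `p` it agrees
  -- with the single extension `G p`, so it is entire.
  have hloc : ∀ p, (fun y => G y y) =ᶠ[𝓝 p] G p := fun p => by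
    have h1 : ∀ᶠ y in 𝓝[≠] p, G y y = G p y := by
      have hGp := (hG p).eventually_analyticAt.filter_mono (nhdsWithin_le_nhds (s := {p}ᶜ))
      filter_upwards [eventually_eventually_nhdsWithin.2 (hFG p), self_mem_nhdsWithin, hGp]
        with y hy hyp hGpy
      refine eq_of_eventuallyEq_nhdsNE (hG y).continuousAt hGpy.continuousAt ?_
      rw [isOpen_compl_singleton.nhdsWithin_eq hyp] at hy
      filter_upwards [hy.filter_mono nhdsWithin_le_nhds, hFG y] with x h3 h4
      rw [← h3, h4]
    rw [eventually_nhdsWithin_iff] at h1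
    filter_upwards [h1] with y hy
    by_cases hyp : y = p
    · rw [hyp]
    · exact hy hyp
  have hd : Differentiable ℂ (fun y => G y y) := fun p =>
    ((hG p).congr (hloc p).symm).differentiableAt
  have hp : ∀ x, ∀ w ∈ L.lattice, G (x + w) (x + w) = G x x := fun x w hw => by
    have hc : ContinuousAt (fun y => G (x + w) (y + w)) x :=
      ContinuousAt.comp (f := fun y => y + w) (hG (x + w)).continuousAt (by fun_prop)
    refine eq_of_eventuallyEq_nhdsNE hc (hG x).continuousAt ?_
    have ht : Tendsto (fun y => y + w) (𝓝[≠] x) (𝓝[≠] (x + w)) := by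
      have := tendsto_affine (s := 1) (t := -w) (p := x + w) (by ring)
      simpa using this
    filter_upwards [hFG x, ht.eventually (hFG (x + w))] with y h1 h2
    rw [← h1, ← h2, hper y w hw]
  refine ⟨G 0 0, fun x hx => ?_⟩
  rw [eq_of_eventuallyEq_nhdsNE hx (hG x).continuousAt (hFG x)]
  exact hd.apply_eq_apply_of_bounded (IsZLattice.isCompact_range_of_periodic L.lattice _
    hd.continuous fun z w hw => hp z w hw).isBounded x 0

/-! ### Half periods -/

theorem mem_lattice_of_rat (L : PeriodPair) (a b : ℚ) :
    a * L.ω₁ + b * L.ω₂ ∈ L.lattice ↔ a.den = 1 ∧ b.den = 1 :=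
  L.mul_ω₁_add_mul_ω₂_mem_lattice

theorem two_mul_halfPeriod_mem (L : PeriodPair) (i : Fin 4) : 2 * halfPeriod L i ∈ L.lattice := by
  have h1 := L.ω₁_mem_lattice
  have h2 := L.ω₂_mem_lattice
  fin_cases i
  · simp [halfPeriod]
  · convert! h1 using 1; simp [halfPeriod]; ring
  · convert! neg_mem (add_mem h1 h2) using 1; simp [halfPeriod]; ring
  · convert! h2 using 1; simp [halfPeriod]; ring

theorem halfPeriod_sub_notMem (L : PeriodPair) {i j : Fin 4} (hij : i ≠ j) :
    halfPeriod L i - halfPeriod L j ∉ L.lattice := by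
  have key : ∀ a b : ℚ, (a.den ≠ 1 ∨ b.den ≠ 1) → ∀ z : ℂ, z = a * L.ω₁ + b * L.ω₂ →
      z ∉ L.lattice := by
    rintro a b h z rfl h2
    rw [mem_lattice_of_rat] at h2
    tauto
  fin_cases i <;> fin_cases j <;> first | exact absurd rfl hij | skip
  · refine key (-1 / 2) 0 (by norm_num) _ ?_; simp [halfPeriod]; ring
  · refine key (1 / 2) (1 / 2) (by norm_num) _ ?_; simp [halfPeriod]; ring
  · refine key 0 (-1 / 2) (by norm_num) _ ?_; simp [halfPeriod]; ring
  · refine key (1 / 2) 0 (by norm_num) _ ?_; simp [halfPeriod]; ring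
  · refine key 1 (1 / 2) (by norm_num) _ ?_; simp [halfPeriod]; ring
  · refine key (1 / 2) (-1 / 2) (by norm_num) _ ?_; simp [halfPeriod]; ring
  · refine key (-1 / 2) (-1 / 2) (by norm_num) _ ?_; simp [halfPeriod]; ring
  · refine key (-1) (-1 / 2) (by norm_num) _ ?_; simp [halfPeriod]; ring
  · refine key (-1 / 2) (-1) (by norm_num) _ ?_; simp [halfPeriod]; ring
  · refine key 0 (1 / 2) (by norm_num) _ ?_; simp [halfPeriod]; ring
  · refine key (-1 / 2) (1 / 2) (by norm_num) _ ?_; simp [halfPeriod]; ring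
  · refine key (1 / 2) 1 (by norm_num) _ ?_; simp [halfPeriod]; ring

theorem exists_halfPeriod_of_two_mul_mem (L : PeriodPair) {p : ℂ} (hp : 2 * p ∈ L.lattice) :
    ∃ i, p + halfPeriod L i ∈ L.lattice := by
  obtain ⟨m, n, h⟩ := PeriodPair.mem_lattice.1 hp
  have key : ∀ i (a b : ℤ), a * L.ω₁ + b * L.ω₂ = p + halfPeriod L i →
      ∃ i, p + halfPeriod L i ∈ L.lattice := fun i a b h =>
    ⟨i, PeriodPair.mem_lattice.2 ⟨a, b, h⟩⟩
  rcases Int.even_or_odd' m with ⟨a, rfl | rfl⟩ <;> rcases Int.even_or_odd' n with ⟨b, rfl | rfl⟩ <;>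
    push_cast at h
  · refine key 0 a b ?_; simp [halfPeriod]; linear_combination h / 2
  · refine key 3 a (b + 1) ?_; simp [halfPeriod]; linear_combination h / 2
  · refine key 1 (a + 1) b ?_; simp [halfPeriod]; linear_combination h / 2
  · refine key 2 a b ?_; simp [halfPeriod]; linear_combination h / 2

/-! ### Local behaviour of `℘` -/

theorem weierstrassP_add_of_mem (L : PeriodPair) (z : ℂ) {w : ℂ} (hw : w ∈ L.lattice) :
    L.weierstrassP (z + w) = L.weierstrassP z := L.weierstrassP_add_coe z ⟨w, hw⟩

/-- The Laurent expansion of `℘` at a lattice point has no linear term. The identity holds even at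
`x = p`, because inverses of zero are zero. -/
theorem weierstrassP_laurent (L : PeriodPair) {p s : ℂ} (h : p + s ∈ L.lattice) :
    ∃ g : ℂ → ℂ, AnalyticAt ℂ g p ∧ deriv g p = 0 ∧
      ∀ x, L.weierstrassP (x + s) = ((x - p) ^ 2)⁻¹ + g x := by
  have h0 : AnalyticAt ℂ (L.weierstrassPExcept 0) (p - p) := by
    rw [sub_self]; exact L.analyticAt_weierstrassPExcept 0
  refine ⟨fun x => L.weierstrassPExcept 0 (x - p), ?_, ?_, fun x => ?_⟩
  · exact h0.comp (f := fun x => x - p) (by fun_prop)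
  · rw [deriv_comp_sub_const (f := L.weierstrassPExcept 0), sub_self,
      L.deriv_weierstrassPExcept_same, L.derivWeierstrassPExcept_zero_zero]
  · rw [show x + s = (x - p) + (p + s) by ring, weierstrassP_add_of_mem L _ h,
      ← L.weierstrassPExcept_add ⟨0, L.lattice.zero_mem⟩]
    simp
    ring

theorem analyticAt_weierstrassP_add (L : PeriodPair) {p s : ℂ} (h : p + s ∉ L.lattice) :
    AnalyticAt ℂ (fun x => L.weierstrassP (x + s)) p :=
  (L.analyticOnNhd_weierstrassP (p + s) h).comp (f := fun x => x + s) (by fun_prop)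

theorem hasDerivAt_weierstrassP (L : PeriodPair) {z : ℂ} (h : z ∉ L.lattice) :
    HasDerivAt L.weierstrassP (L.derivWeierstrassP z) z := by
  rw [← L.deriv_weierstrassP]
  exact (L.analyticOnNhd_weierstrassP z h).differentiableAt.hasDerivAt

theorem add_notMem_of_sub_notMem (L : PeriodPair) {x w : ℂ} (hw : 2 * w ∈ L.lattice)
    (h : x - w ∉ L.lattice) : x + w ∉ L.lattice := fun h' =>
  h (by have := sub_mem h' hw; rwa [show x + w - 2 * w = x - w by ring] at this)

/-- The derivative of the duplication formula `4 ℘(2z) = ∑ ℘(z + ω_i)`. -/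
theorem derivWeierstrassP_two_mul (L : PeriodPair) {z : ℂ} (hz : 2 * z ∉ L.lattice) :
    8 * L.derivWeierstrassP (2 * z) = ∑ i, L.derivWeierstrassP (z + halfPeriod L i) := by
  set F : ℂ → ℂ := fun z => 4 * L.weierstrassP (2 * z) - ∑ i, L.weierstrassP (z + halfPeriod L i)
    with hFdef
  have han2 : ∀ p, 2 * p ∉ L.lattice → AnalyticAt ℂ (fun x => L.weierstrassP (2 * x)) p :=
    fun p hp => (L.analyticOnNhd_weierstrassP (2 * p) hp).comp (f := fun x => 2 * x) (by fun_prop)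
  have hmem : ∀ p i, p + halfPeriod L i ∈ L.lattice → 2 * p ∈ L.lattice := fun p i h => by
    have := sub_mem (add_mem h h) (two_mul_halfPeriod_mem L i)
    rwa [show p + halfPeriod L i + (p + halfPeriod L i) - 2 * halfPeriod L i = 2 * p by ring] at this
  have han : ∀ p, 2 * p ∉ L.lattice → AnalyticAt ℂ F p := fun p hp =>
    (analyticAt_const.mul (han2 p hp)).sub (Finset.analyticAt_fun_sum _ fun i _ =>
      analyticAt_weierstrassP_add L fun h => hp (hmem p i h))
  -- If `2 p ∈ Λ`, exactly one translate `℘(x + ω_i)` has a pole at `p`, and its principal part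
  -- equals `4 (2 (x - p))⁻²`. So `F` is an elliptic function without poles.
  have hpole : ∀ p, PoleLE 0 F p := fun p => by
    by_cases hp : 2 * p ∈ L.lattice
    · obtain ⟨i, hi⟩ := exists_halfPeriod_of_two_mul_mem L hp
      obtain ⟨g, hg, -, hgx⟩ := weierstrassP_laurent L hi
      obtain ⟨k, hk, -, hkx⟩ := weierstrassP_laurent L (p := 2 * p) (s := 0) (by simpa using hp)
      have hk2 : AnalyticAt ℂ (fun x => k (2 * x)) p := hk.comp (f := fun x => 2 * x) (by fun_prop)
      have hj : AnalyticAt ℂ (fun x => ∑ j ∈ Finset.univ.erase i,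
          L.weierstrassP (x + halfPeriod L j)) p :=
        Finset.analyticAt_fun_sum _ fun j hj => analyticAt_weierstrassP_add L fun h => by
          have := sub_mem h hi
          rw [show p + halfPeriod L j - (p + halfPeriod L i) = halfPeriod L j - halfPeriod L i
            by ring] at this
          exact halfPeriod_sub_notMem L (Finset.ne_of_mem_erase hj) this
      refine (poleLE_zero_of_analyticAt (f := fun x => 4 * k (2 * x) - (g x +
        ∑ j ∈ Finset.univ.erase i, L.weierstrassP (x + halfPeriod L j))) (by fun_prop)).congr ?_
      filter_upwards [self_mem_nhdsWithin] with x hx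
      have hne : x - p ≠ 0 := sub_ne_zero.2 hx
      have h2 := hkx (2 * x)
      rw [add_zero, ← mul_sub] at h2
      simp only [hFdef]
      rw [← Finset.add_sum_erase _ _ (Finset.mem_univ i), hgx, h2]
      field_simp
      ring
    · exact poleLE_zero_of_analyticAt (han p hp)
  obtain ⟨c, hc⟩ := exists_const_of_periodic L hpole fun x w hw => by
    simp only [hFdef]
    rw [mul_add, weierstrassP_add_of_mem L _ (by simpa [two_mul] using add_mem hw hw)]
    simp only [add_right_comm x w, weierstrassP_add_of_mem L _ hw]
  have hconst : F =ᶠ[𝓝 z] fun _ => c := by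
    filter_upwards [(han z hz).eventually_analyticAt] with x hx using hc x hx.continuousAt
  have hd : HasDerivAt F (4 * (L.derivWeierstrassP (2 * z) * (2 * 1)) -
      ∑ i, L.derivWeierstrassP (z + halfPeriod L i) * 1) z := by
    refine (((hasDerivAt_weierstrassP L hz).comp z
      ((hasDerivAt_id z).const_mul 2)).const_mul 4).sub (HasDerivAt.fun_sum fun i _ => ?_)
    exact (hasDerivAt_weierstrassP L fun h => hz (hmem z i h)).comp z
      ((hasDerivAt_id z).add_const (halfPeriod L i))
  have := hd.unique ((hasDerivAt_const z c).congr_of_eventuallyEq hconst)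
  simp only [mul_one] at this
  linear_combination this

/-! ### The potential -/

/-- The points `ω_i`, `±δ_j` are pairwise incongruent modulo the lattice. -/
structure Generic (L : PeriodPair) {M : ℕ} (δ : Fin M → ℂ) : Prop where
  add_half : ∀ j i, δ j + halfPeriod L i ∉ L.lattice
  sub_half : ∀ j i, δ j - halfPeriod L i ∉ L.lattice
  add : ∀ j j', δ j + δ j' ∉ L.lattice
  sub : ∀ j j', j ≠ j' → δ j - δ j' ∉ L.lattice

theorem generic_of {L : PeriodPair} {M : ℕ} {δ : Fin M → ℂ}
    (hδ : ∀ j i, δ j - halfPeriod L i ∉ L.lattice)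
    (hδδ : ∀ j j', j < j' → δ j - δ j' ∉ L.lattice ∧ δ j + δ j' ∉ L.lattice) : Generic L δ where
  add_half j i := add_notMem_of_sub_notMem L (two_mul_halfPeriod_mem L i) (hδ j i)
  sub_half := hδ
  add j j' := by
    rcases lt_trichotomy j j' with h | rfl | h
    · exact (hδδ j j' h).2
    -- On the diagonal, `2 δ_j ∈ Λ` would make `δ_j` congruent to a half period.
    · intro h
      obtain ⟨i, hi⟩ := exists_halfPeriod_of_two_mul_mem L (p := δ j) (by rwa [two_mul])
      exact add_notMem_of_sub_notMem L (two_mul_halfPeriod_mem L i) (hδ j i) hi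
    · rw [add_comm]; exact (hδδ j' j h).2
  sub j j' h := by
    rcases lt_or_gt_of_ne h with h | h
    · exact (hδδ j j' h).1
    · intro h'
      refine (hδδ j' j h).1 ?_
      rw [← neg_sub]; exact neg_mem h'

/-- The points which are not poles of the potential. -/
def regularSet (L : PeriodPair) (l : Fin 4 → ℕ) {M : ℕ} (δ : Fin M → ℂ) : Set ℂ :=
  {x | (∀ i, l i ≠ 0 → x + halfPeriod L i ∉ L.lattice) ∧
    ∀ j, x - δ j ∉ L.lattice ∧ x + δ j ∉ L.lattice}

theorem potential_add (L : PeriodPair) (l : Fin 4 → ℕ) {M : ℕ} (δ : Fin M → ℂ) (x : ℂ) {w : ℂ}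
    (hw : w ∈ L.lattice) : potential L l δ (x + w) = potential L l δ x := by
  simp only [potential, add_right_comm x w, add_sub_right_comm x w, weierstrassP_add_of_mem L _ hw]

theorem weierstrassP_sub_half (L : PeriodPair) (i : Fin 4) (x : ℂ) :
    L.weierstrassP (x - halfPeriod L i) = L.weierstrassP (x + halfPeriod L i) := by
  rw [← weierstrassP_add_of_mem L _ (two_mul_halfPeriod_mem L i)]
  congr 1; ring

theorem weierstrassP_neg_add (L : PeriodPair) (s x : ℂ) :
    L.weierstrassP (-x + s) = L.weierstrassP (x - s) := by
  rw [← L.weierstrassP_neg]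
  congr 1; ring

theorem weierstrassP_neg_sub (L : PeriodPair) (s x : ℂ) :
    L.weierstrassP (-x - s) = L.weierstrassP (x + s) := by
  rw [← L.weierstrassP_neg]
  congr 1; ring

theorem potential_neg (L : PeriodPair) (l : Fin 4 → ℕ) {M : ℕ} (δ : Fin M → ℂ) (x : ℂ) :
    potential L l δ (-x) = potential L l δ x := by
  simp only [potential, weierstrassP_neg_add, weierstrassP_neg_sub, weierstrassP_sub_half]
  simp only [add_comm (L.weierstrassP (_ + _)) (L.weierstrassP (_ - _))]

theorem analyticAt_weierstrassP_sub (L : PeriodPair) {p s : ℂ} (h : p - s ∉ L.lattice) :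
    AnalyticAt ℂ (fun x => L.weierstrassP (x - s)) p := by
  simp only [sub_eq_add_neg] at h ⊢
  exact analyticAt_weierstrassP_add L h

theorem meromorphic_weierstrassP_add (L : PeriodPair) (s : ℂ) :
    Meromorphic (fun x => L.weierstrassP (x + s)) :=
  Meromorphic.meromorphic_fun_comp_add_const_iff_meromorphic.2 L.meromorphic_weierstrassP

theorem meromorphic_weierstrassP_sub (L : PeriodPair) (s : ℂ) :
    Meromorphic (fun x => L.weierstrassP (x - s)) :=
  Meromorphic.meromorphic_fun_comp_sub_const_iff_meromorphic.2 L.meromorphic_weierstrassP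

theorem meromorphic_potential (L : PeriodPair) (l : Fin 4 → ℕ) {M : ℕ} (δ : Fin M → ℂ) :
    Meromorphic (potential L l δ) := fun x =>
  (MeromorphicAt.fun_sum fun _ _ => (MeromorphicAt.const _ x).mul
    (meromorphic_weierstrassP_add L _ x)).add ((MeromorphicAt.const _ x).mul
      (MeromorphicAt.fun_sum fun _ _ => (meromorphic_weierstrassP_sub L _ x).add
        (meromorphic_weierstrassP_add L _ x)))

theorem analyticAt_potential {L : PeriodPair} {l : Fin 4 → ℕ} {M : ℕ} {δ : Fin M → ℂ} {x : ℂ}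
    (hx : x ∈ regularSet L l δ) : AnalyticAt ℂ (potential L l δ) x := by
  refine (Finset.analyticAt_fun_sum _ fun i _ => ?_).add (analyticAt_const.mul
    (Finset.analyticAt_fun_sum _ fun j _ => (analyticAt_weierstrassP_sub L (hx.2 j).1).add
      (analyticAt_weierstrassP_add L (hx.2 j).2)))
  by_cases h : l i = 0
  · simp only [h, Nat.cast_zero, zero_mul]; exact analyticAt_const
  · exact analyticAt_const.mul (analyticAt_weierstrassP_add L (hx.1 i h))

theorem notMem_of_sub_mem (L : PeriodPair) {a b d : ℂ} (ha : a ∈ L.lattice) (hd : d ∉ L.lattice)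
    (h : b - a = d ∨ a - b = d ∨ a + b = d ∨ -a - b = d) : b ∉ L.lattice := fun hb => by
  rcases h with rfl | rfl | rfl | rfl
  · exact hd (sub_mem hb ha)
  · exact hd (sub_mem ha hb)
  · exact hd (add_mem ha hb)
  · exact hd (sub_mem (neg_mem ha) hb)

theorem potential_laurent_half {L : PeriodPair} (l : Fin 4 → ℕ) {M : ℕ} {δ : Fin M → ℂ}
    (hg : Generic L δ) {i : Fin 4} {p : ℂ} (hp : p + halfPeriod L i ∈ L.lattice) :
    ∃ h : ℂ → ℂ, AnalyticAt ℂ h p ∧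
      ∀ x, potential L l δ x = l i * (l i + 1) * ((x - p) ^ 2)⁻¹ + h x := by
  obtain ⟨g, hga, -, hgx⟩ := weierstrassP_laurent L hp
  refine ⟨fun x => l i * (l i + 1) * g x + (∑ i' ∈ Finset.univ.erase i,
    (l i' : ℂ) * ((l i' : ℂ) + 1) * L.weierstrassP (x + halfPeriod L i') +
    2 * ∑ i' : Fin M, (L.weierstrassP (x - δ i') + L.weierstrassP (x + δ i'))), ?_, fun x => ?_⟩
  · refine (analyticAt_const.mul hga).add ((Finset.analyticAt_fun_sum _ fun j hj =>
      analyticAt_const.mul (analyticAt_weierstrassP_add L ?_)).add (analyticAt_const.mul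
      (Finset.analyticAt_fun_sum _ fun j _ => (analyticAt_weierstrassP_sub L ?_).add
      (analyticAt_weierstrassP_add L ?_))))
    · exact notMem_of_sub_mem L hp (halfPeriod_sub_notMem L (Finset.ne_of_mem_erase hj))
        (by left; ring)
    · exact notMem_of_sub_mem L hp (hg.add_half j i) (by right; left; ring)
    · exact notMem_of_sub_mem L hp (hg.sub_half j i) (by left; ring)
  · rw [potential, ← Finset.add_sum_erase _ _ (Finset.mem_univ i), hgx]
    ring

/-- The only use of the equations for `δ`: they say that the regular part `h` of the potential at
`δ_j` has vanishing first derivative there. -/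
theorem potential_laurent_delta {L : PeriodPair} (l : Fin 4 → ℕ) {M : ℕ} {δ : Fin M → ℂ}
    (hg : Generic L δ) (j : Fin M)
    (heq : 2 * ∑ j' ∈ Finset.univ.erase j,
          (L.derivWeierstrassP (δ j - δ j') + L.derivWeierstrassP (δ j + δ j')) +
        ∑ i : Fin 4, ((l i : ℂ) + 1 / 2) ^ 2 *
          L.derivWeierstrassP (δ j + halfPeriod L i) = 0) :
    ∃ h : ℂ → ℂ, AnalyticAt ℂ h (δ j) ∧ deriv h (δ j) = 0 ∧
      ∀ x, potential L l δ x = 2 * ((x - δ j) ^ 2)⁻¹ + h x := by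
  obtain ⟨g, hga, hg0, hgx⟩ := weierstrassP_laurent L (p := δ j) (s := -δ j) (by simp)
  simp only [← sub_eq_add_neg] at hgx
  have hP : ∀ s : ℂ, δ j + s ∉ L.lattice → HasDerivAt (fun x => L.weierstrassP (x + s))
      (L.derivWeierstrassP (δ j + s)) (δ j) := fun s hs =>
    (hasDerivAt_weierstrassP L hs).comp_add_const (δ j) s
  have hQ : ∀ s : ℂ, δ j - s ∉ L.lattice → HasDerivAt (fun x => L.weierstrassP (x - s))
      (L.derivWeierstrassP (δ j - s)) (δ j) := fun s hs =>
    (hasDerivAt_weierstrassP L hs).comp_sub_const (δ j) s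
  refine ⟨fun x => ∑ i, (l i : ℂ) * ((l i : ℂ) + 1) * L.weierstrassP (x + halfPeriod L i) +
    2 * (g x + L.weierstrassP (x + δ j) + ∑ j' ∈ Finset.univ.erase j,
      (L.weierstrassP (x - δ j') + L.weierstrassP (x + δ j'))), ?_, ?_, fun x => ?_⟩
  · refine (Finset.analyticAt_fun_sum _ fun i _ =>
      analyticAt_const.mul (analyticAt_weierstrassP_add L (hg.add_half j i))).add
      (analyticAt_const.mul ((hga.add (analyticAt_weierstrassP_add L (hg.add j j))).add
      (Finset.analyticAt_fun_sum _ fun j' hj' => (analyticAt_weierstrassP_sub L ?_).add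
      (analyticAt_weierstrassP_add L (hg.add j j')))))
    exact hg.sub j j' (Finset.ne_of_mem_erase hj').symm
  · have hd := (HasDerivAt.fun_sum fun i (_ : i ∈ Finset.univ) =>
      (hP _ (hg.add_half j i)).const_mul ((l i : ℂ) * ((l i : ℂ) + 1))).add
      (((hga.differentiableAt.hasDerivAt.add (hP _ (hg.add j j))).add
      (HasDerivAt.fun_sum fun j' (hj' : j' ∈ Finset.univ.erase j) =>
        (hQ _ (hg.sub j j' (Finset.ne_of_mem_erase hj').symm)).add
          (hP _ (hg.add j j')))).const_mul 2)
    refine hd.deriv.trans ?_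
    rw [hg0, ← two_mul (δ j)]
    have hdup := derivWeierstrassP_two_mul L (z := δ j) (by rw [two_mul]; exact hg.add j j)
    -- Since `(l + 1/2)² = l (l + 1) + 1/4`, the extra quarter of `∑ ℘'(δ_j + ω_i)` equals `2 ℘'(2
    -- δ_j)` by duplication. This is the contribution of `2 ℘(x + δ_j)` to `h'(δ_j)`, absent from
    -- the sum over `j' ≠ j`.
    have hs : ∑ i : Fin 4, ((l i : ℂ) + 1 / 2) ^ 2 * L.derivWeierstrassP (δ j + halfPeriod L i) =
        ∑ i, (l i : ℂ) * ((l i : ℂ) + 1) * L.derivWeierstrassP (δ j + halfPeriod L i) +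
        1 / 4 * ∑ i, L.derivWeierstrassP (δ j + halfPeriod L i) := by
      rw [Finset.mul_sum, ← Finset.sum_add_distrib]
      exact Finset.sum_congr rfl fun i _ => by ring
    linear_combination heq - hs + 1 / 4 * hdup
  · rw [potential, ← Finset.add_sum_erase _ _ (Finset.mem_univ j), hgx]
    ring

theorem not_analyticAt_of_laurent {f h : ℂ → ℂ} {p c : ℂ} (hc : c ≠ 0) (hh : AnalyticAt ℂ h p)
    (hf : ∀ x, f x = c * ((x - p) ^ 2)⁻¹ + h x) : ¬ AnalyticAt ℂ f p := fun hfa => by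
  have h1 : (fun _ : ℂ => c) p = (fun x => (x - p) ^ 2 * (f x - h x)) p := by
    have h2 : AnalyticAt ℂ (fun x => (x - p) ^ 2 * (f x - h x)) p := by fun_prop
    refine eq_of_eventuallyEq_nhdsNE (F := fun _ : ℂ => c)
      (G := fun x => (x - p) ^ 2 * (f x - h x)) continuousAt_const
      h2.continuousAt ?_
    filter_upwards [self_mem_nhdsWithin] with x hx
    have hne : x - p ≠ 0 := sub_ne_zero.2 hx
    rw [hf]; field_simp; ring
  simp at h1
  exact hc h1

theorem analyticAt_of_comp_affine {F : ℂ → ℂ} {p s t : ℂ}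
    (hF : ∀ x, F (s * x + t) = F x) (h : AnalyticAt ℂ F (s * p + t)) : AnalyticAt ℂ F p := by
  have h2 : AnalyticAt ℂ (fun x => F (s * x + t)) p :=
    AnalyticAt.comp (f := fun x => s * x + t) h (by fun_prop)
  rwa [funext hF] at h2

/-- Every candidate pole is a genuine one: its leading coefficient is `l_i (l_i + 1) ≠ 0` or `2`,
and periodicity and evenness carry the expansion at `δ_j` to all points congruent to `±δ_j`. -/
theorem analyticAt_potential_iff {L : PeriodPair} {l : Fin 4 → ℕ} {M : ℕ} {δ : Fin M → ℂ}
    (hg : Generic L δ)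
    (heq : ∀ j, 2 * ∑ j' ∈ Finset.univ.erase j,
          (L.derivWeierstrassP (δ j - δ j') + L.derivWeierstrassP (δ j + δ j')) +
        ∑ i : Fin 4, ((l i : ℂ) + 1 / 2) ^ 2 *
          L.derivWeierstrassP (δ j + halfPeriod L i) = 0) {x : ℂ} :
    AnalyticAt ℂ (potential L l δ) x ↔ x ∈ regularSet L l δ := by
  refine ⟨fun h => ⟨fun i hi hx => ?_, fun j => ?_⟩, analyticAt_potential⟩
  · obtain ⟨k, hk, hkx⟩ := potential_laurent_half l hg hx
    refine not_analyticAt_of_laurent (mul_ne_zero ?_ ?_) hk hkx h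
    · exact_mod_cast hi
    · exact_mod_cast (l i).succ_ne_zero
  · obtain ⟨k, hk, -, hkx⟩ := potential_laurent_delta l hg j (heq j)
    have hna := not_analyticAt_of_laurent two_ne_zero hk hkx
    constructor
    · intro hx
      refine hna (analyticAt_of_comp_affine (s := 1) (t := x - δ j) (fun y => ?_) (by simpa using h))
      rw [one_mul, potential_add _ _ _ _ hx]
    · intro hx
      refine hna (analyticAt_of_comp_affine (s := -1) (t := x + δ j) (fun y => ?_)
        (by simpa using h))
      rw [neg_one_mul, potential_add _ _ _ _ hx, potential_neg]

/-! ### Pole orders of the formal coefficients -/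

theorem evenAbout_of_half {L : PeriodPair} {F : ℂ → ℂ} (hneg : ∀ x, F (-x) = F x)
    (hper : ∀ x, ∀ w ∈ L.lattice, F (x + w) = F x) {i : Fin 4} {p : ℂ}
    (hp : p + halfPeriod L i ∈ L.lattice) : EvenAbout p F := fun x => by
  have h2 : 2 * p ∈ L.lattice := by
    have := sub_mem (add_mem hp hp) (two_mul_halfPeriod_mem L i)
    rwa [show p + halfPeriod L i + (p + halfPeriod L i) - 2 * halfPeriod L i = 2 * p by ring] at this
  rw [show 2 * p - x = -x + 2 * p by ring, hper _ _ h2, hneg]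

theorem formalCoeff_potential_neg (L : PeriodPair) (l : Fin 4 → ℕ) {M : ℕ} (δ : Fin M → ℂ) (n : ℕ)
    (x : ℂ) : formalCoeff (potential L l δ) n (-x) = formalCoeff (potential L l δ) n x := by
  have := formalCoeff_comp_affine (v := potential L l δ) (s := -1) (t := 0) (by ring)
    (fun x => by rw [neg_one_mul, add_zero, potential_neg]) n x
  simpa using this

theorem formalCoeff_potential_add (L : PeriodPair) (l : Fin 4 → ℕ) {M : ℕ} (δ : Fin M → ℂ) (n : ℕ)
    (x : ℂ) {w : ℂ} (hw : w ∈ L.lattice) :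
    formalCoeff (potential L l δ) n (x + w) = formalCoeff (potential L l δ) n x := by
  have := formalCoeff_comp_affine (v := potential L l δ) (s := 1) (t := w) (by ring)
    (fun x => by rw [one_mul, potential_add _ _ _ _ hw]) n x
  simpa using this

theorem eventually_deriv_formalCoeff {v : ℂ → ℂ} (hv : Meromorphic v) (n : ℕ) (p : ℂ) :
    ∀ᶠ x in 𝓝[≠] p,
      deriv (formalCoeff v (n + 1)) x = -(1 / 4) * thirdOrder v (formalCoeff v n) x := by
  filter_upwards [(hv p).eventually_analyticAt] with x hx using deriv_formalCoeff_succ hx n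

/-- Induction on `n`: the bound goes from `2l` to `2l + 2` under the third order operator, to `2l +
1` under integration, and back to `2l` by evenness about `p`. -/
theorem poleLE_formalCoeff_half {L : PeriodPair} (l : Fin 4 → ℕ) {M : ℕ} {δ : Fin M → ℂ}
    (hg : Generic L δ) {i : Fin 4} {p : ℂ} (hp : p + halfPeriod L i ∈ L.lattice) (n : ℕ) :
    PoleLE (2 * l i) (formalCoeff (potential L l δ) n) p := by
  obtain ⟨h, hh, hv⟩ := potential_laurent_half l hg hp
  have hm := meromorphic_potential L l δ
  induction n with
  | zero =>
    rw [formalCoeff_zero]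
    exact (poleLE_zero_of_analyticAt analyticAt_const).mono (Nat.zero_le _)
  | succ n ih =>
    refine PoleLE.of_evenAbout (evenAbout_of_half (formalCoeff_potential_neg L l δ _)
      (fun x w hw => formalCoeff_potential_add L l δ _ x hw) hp)
      (PoleLE.of_deriv (meromorphic_formalCoeff hm _ p) ?_)
    refine ((ih.thirdOrder_of_even_pole hh (.of_forall hv)).const_mul (-(1 / 4))).congr ?_
    filter_upwards [eventually_deriv_formalCoeff hm n p] with x hx using hx.symm

/-- Evenness about `δ_j` is not available here, since `2 δ_j ∉ Λ`; simple poles are excluded by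
`h'(δ_j) = 0` instead. -/
theorem doublePole_formalCoeff_delta {L : PeriodPair} {l : Fin 4 → ℕ} {M : ℕ} {δ : Fin M → ℂ}
    (hg : Generic L δ) (j : Fin M)
    (heq : 2 * ∑ j' ∈ Finset.univ.erase j,
          (L.derivWeierstrassP (δ j - δ j') + L.derivWeierstrassP (δ j + δ j')) +
        ∑ i : Fin 4, ((l i : ℂ) + 1 / 2) ^ 2 *
          L.derivWeierstrassP (δ j + halfPeriod L i) = 0) (n : ℕ) :
    DoublePole (formalCoeff (potential L l δ) n) (δ j) := by
  obtain ⟨h, hh, hh0, hv⟩ := potential_laurent_delta l hg j heq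
  have hm := meromorphic_potential L l δ
  induction n with
  | zero =>
    rw [formalCoeff_zero]
    exact ⟨0, fun _ => 1, analyticAt_const, by simp⟩
  | succ n ih =>
    exact ih.of_deriv_eq_thirdOrder hh hh0 (.of_forall hv) (meromorphic_formalCoeff hm _ _)
      (eventually_deriv_formalCoeff hm n _)

/-! ### Even elliptic functions with prescribed poles -/

/-- The index set of the elliptic functions out of which `Ξ` is built. -/
abbrev BasisIndex (l : Fin 4 → ℕ) (M : ℕ) : Type := Unit ⊕ (Σ i : Fin 4, Fin (l i)) ⊕ Fin M

/-- The functions `1`, `℘(x+ω_i)^(l_i-j)` and `℘(x+δ)+℘(x-δ)`. -/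
noncomputable def basisFun (L : PeriodPair) (l : Fin 4 → ℕ) {M : ℕ} (δ : Fin M → ℂ) :
    BasisIndex l M → ℂ → ℂ
  | .inl _ => fun _ => 1
  | .inr (.inl ⟨i, j⟩) => fun x => L.weierstrassP (x + halfPeriod L i) ^ (l i - (j : ℕ))
  | .inr (.inr j) => fun x => L.weierstrassP (x + δ j) + L.weierstrassP (x - δ j)

theorem basisFun_add (L : PeriodPair) (l : Fin 4 → ℕ) {M : ℕ} (δ : Fin M → ℂ) (s : BasisIndex l M)
    (x : ℂ) {w : ℂ} (hw : w ∈ L.lattice) : basisFun L l δ s (x + w) = basisFun L l δ s x := by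
  rcases s with s | ⟨i, j⟩ | j <;>
    simp only [basisFun, add_right_comm x w, add_sub_right_comm x w, weierstrassP_add_of_mem L _ hw]

theorem basisFun_neg (L : PeriodPair) (l : Fin 4 → ℕ) {M : ℕ} (δ : Fin M → ℂ) (s : BasisIndex l M)
    (x : ℂ) : basisFun L l δ s (-x) = basisFun L l δ s x := by
  rcases s with s | ⟨i, j⟩ | j <;>
    simp only [basisFun, weierstrassP_neg_add, weierstrassP_neg_sub, weierstrassP_sub_half]
  rw [add_comm]

theorem meromorphic_basisFun (L : PeriodPair) (l : Fin 4 → ℕ) {M : ℕ} (δ : Fin M → ℂ)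
    (s : BasisIndex l M) : Meromorphic (basisFun L l δ s) := by
  rcases s with s | ⟨i, j⟩ | j
  · exact Meromorphic.const _
  · exact (meromorphic_weierstrassP_add L _).fun_pow
  · exact (meromorphic_weierstrassP_add L _).fun_add (meromorphic_weierstrassP_sub L _)

theorem analyticAt_basisFun {L : PeriodPair} {l : Fin 4 → ℕ} {M : ℕ} {δ : Fin M → ℂ}
    (s : BasisIndex l M) {x : ℂ} (hx : x ∈ regularSet L l δ) : AnalyticAt ℂ (basisFun L l δ s) x := by
  rcases s with s | ⟨i, j⟩ | j
  · exact analyticAt_const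
  · exact (analyticAt_weierstrassP_add L (hx.1 i (by have := j.2; omega))).fun_pow _
  · exact (analyticAt_weierstrassP_add L (hx.2 j).2).fun_add
      (analyticAt_weierstrassP_sub L (hx.2 j).1)

/-- Subtracting a multiple of the top power of `℘` lowers the pole order by one, and evenness lowers
it once more; then induct. The index `0` of `β` belongs to the highest power. -/
theorem exists_principal_part (L : PeriodPair) {p s : ℂ} (hp : p + s ∈ L.lattice) (n : ℕ)
    {F : ℂ → ℂ} (he : EvenAbout p F) (hF : PoleLE (2 * n) F p) : ∃ β : Fin n → ℂ,
      PoleLE 0 (fun x => F x - ∑ j, β j * L.weierstrassP (x + s) ^ (n - (j : ℕ))) p := by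
  induction n generalizing F with
  | zero => exact ⟨fun _ => 0, by simpa using hF⟩
  | succ n ih =>
    obtain ⟨G, hG, hFG⟩ := hF
    obtain ⟨g, hg, -, hgx⟩ := weierstrassP_laurent L hp
    have hq : EvenAbout p fun x => L.weierstrassP (x + s) := fun x => by
      dsimp only
      rw [← L.weierstrassP_neg, ← weierstrassP_add_of_mem L (x + s) (neg_mem (add_mem hp hp))]
      congr 1; ring
    have hstep : PoleLE (2 * n + 1) (fun x => F x - G p * L.weierstrassP (x + s) ^ (n + 1)) p := by
      refine PoleLE.of_pole_succ (G := fun x => G x - G p * (1 + (x - p) ^ 2 * g x) ^ (n + 1))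
        (by fun_prop) ?_ (by simp)
      filter_upwards [hFG, self_mem_nhdsWithin] with x hx hxp
      have hne : x - p ≠ 0 := sub_ne_zero.2 hxp
      have e : 1 + (x - p) ^ 2 * g x = (x - p) ^ 2 * L.weierstrassP (x + s) := by
        rw [hgx]; field_simp
      rw [e, ← hx, mul_pow, ← pow_mul]
      ring
    have heven : EvenAbout p fun x => F x - G p * L.weierstrassP (x + s) ^ (n + 1) := fun x => by
      have := hq x
      dsimp only at this ⊢
      rw [he x, this]
    obtain ⟨β, hβ⟩ := ih heven (hstep.of_evenAbout heven)
    refine ⟨Fin.cons (G p) β, hβ.congr (.of_forall fun x => ?_)⟩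
    simp only [Fin.sum_univ_succ, Fin.cons_zero, Fin.cons_succ, Fin.val_zero, Fin.val_succ,
      Nat.sub_zero, Nat.add_sub_add_right]
    ring

/-- Subtract the principal parts at `-ω_i` and `δ_j`. The remainder is even and periodic, so it is
regular also at `-δ_j` and at all translates, hence constant. -/
theorem mem_span_basisFun {L : PeriodPair} {l : Fin 4 → ℕ} {M : ℕ} {δ : Fin M → ℂ}
    (hg : Generic L δ) {F : ℂ → ℂ} (hneg : ∀ x, F (-x) = F x)
    (hper : ∀ x, ∀ w ∈ L.lattice, F (x + w) = F x) (han : ∀ x ∈ regularSet L l δ, AnalyticAt ℂ F x)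
    (hhalf : ∀ i, PoleLE (2 * l i) F (-halfPeriod L i)) (hdelta : ∀ j, DoublePole F (δ j)) :
    ∃ w : BasisIndex l M → ℂ, ∀ x ∈ regularSet L l δ, F x = ∑ s, w s * basisFun L l δ s x := by
  have hp : ∀ i, -halfPeriod L i + halfPeriod L i ∈ L.lattice := fun i => by simp
  choose β hβ using fun i => exists_principal_part L (hp i) (l i)
    (evenAbout_of_half hneg hper (hp i)) (hhalf i)
  choose α g hga hgx using hdelta
  -- The coefficient of the constant function is left at zero and replaced at the end by the
  -- Liouville constant.
  let w : BasisIndex l M → ℂ := Sum.elim (fun _ => 0) (Sum.elim (fun s => β s.1 s.2) α)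
  set R : ℂ → ℂ := fun x => F x - ∑ s, w s * basisFun L l δ s x with hR
  have hRx : ∀ x, R x = F x - (∑ i, ∑ j : Fin (l i), β i j *
      L.weierstrassP (x + halfPeriod L i) ^ (l i - (j : ℕ)) +
      ∑ j, α j * (L.weierstrassP (x + δ j) + L.weierstrassP (x - δ j))) := fun x => by
    simp only [hR, w, Fintype.sum_sum_type, Fintype.sum_sigma, basisFun, Sum.elim_inl, Sum.elim_inr]
    simp
  have hRneg : ∀ x, R (-x) = R x := fun x => by simp only [hR, hneg, basisFun_neg]
  have hRper : ∀ x, ∀ w ∈ L.lattice, R (x + w) = R x := fun x w hw => by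
    simp only [hR, hper _ _ hw, basisFun_add _ _ _ _ _ hw]
  have hRan : ∀ x ∈ regularSet L l δ, AnalyticAt ℂ R x := fun x hx =>
    (han x hx).sub (Finset.analyticAt_fun_sum _ fun s _ =>
      analyticAt_const.mul (analyticAt_basisFun s hx))
  have hRhalf : ∀ i, PoleLE 0 R (-halfPeriod L i) := fun i => by
    have h2 : AnalyticAt ℂ (fun x => ∑ i' ∈ Finset.univ.erase i, ∑ j : Fin (l i'), β i' j *
        L.weierstrassP (x + halfPeriod L i') ^ (l i' - (j : ℕ)) +
        ∑ j, α j * (L.weierstrassP (x + δ j) + L.weierstrassP (x - δ j))) (-halfPeriod L i) := by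
      refine (Finset.analyticAt_fun_sum _ fun i' hi' => Finset.analyticAt_fun_sum _ fun j _ =>
        analyticAt_const.mul (AnalyticAt.fun_pow (analyticAt_weierstrassP_add L ?_) _)).add
        (Finset.analyticAt_fun_sum _ fun j _ => analyticAt_const.mul
        ((analyticAt_weierstrassP_add L ?_).add (analyticAt_weierstrassP_sub L ?_)))
      · exact notMem_of_sub_mem L (hp i) (halfPeriod_sub_notMem L (Finset.ne_of_mem_erase hi'))
          (by left; ring)
      · exact notMem_of_sub_mem L (hp i) (hg.sub_half j i) (by left; ring)
      · exact notMem_of_sub_mem L (hp i) (hg.add_half j i) (by right; left; ring)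
    refine ((hβ i).sub (poleLE_zero_of_analyticAt h2)).congr (.of_forall fun x => ?_)
    rw [hRx, ← Finset.add_sum_erase _ _ (Finset.mem_univ i)]
    ring
  have hRdelta : ∀ j, PoleLE 0 R (δ j) := fun j => by
    obtain ⟨k, hk, -, hkx⟩ := weierstrassP_laurent L (p := δ j) (s := -δ j) (by simp)
    simp only [← sub_eq_add_neg] at hkx
    have h2 : AnalyticAt ℂ (fun x => g j x - (∑ i, ∑ j : Fin (l i), β i j *
        L.weierstrassP (x + halfPeriod L i) ^ (l i - (j : ℕ)) +
        (α j * (L.weierstrassP (x + δ j) + k x) +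
        ∑ j' ∈ Finset.univ.erase j,
          α j' * (L.weierstrassP (x + δ j') + L.weierstrassP (x - δ j'))))) (δ j) := by
      refine (hga j).sub ((Finset.analyticAt_fun_sum _ fun i _ => Finset.analyticAt_fun_sum _
        fun j _ => analyticAt_const.mul
          (AnalyticAt.fun_pow (analyticAt_weierstrassP_add L (hg.add_half _ i)) _)).add
        ((analyticAt_const.mul ((analyticAt_weierstrassP_add L (hg.add j j)).add hk)).add
        (Finset.analyticAt_fun_sum _ fun j' hj' => analyticAt_const.mul
        ((analyticAt_weierstrassP_add L (hg.add j j')).add (analyticAt_weierstrassP_sub L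
          (hg.sub j j' (Finset.ne_of_mem_erase hj').symm))))))
    refine (poleLE_zero_of_analyticAt h2).congr ?_
    filter_upwards [hgx j] with x hx
    rw [hRx, hx, ← Finset.add_sum_erase _ _ (Finset.mem_univ j), hkx]
    ring
  have htrans : ∀ p q, q - p ∈ L.lattice → PoleLE 0 R p → PoleLE 0 R q := fun p q hpq h => by
    have := h.comp_affine (s := 1) (t := q - p) (by ring)
      (fun x => by rw [one_mul, hRper _ _ hpq])
    simpa using this
  have hRpole : ∀ p, PoleLE 0 R p := fun p => by
    by_cases hpr : p ∈ regularSet L l δ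
    · exact poleLE_zero_of_analyticAt (hRan p hpr)
    simp only [regularSet, Set.mem_ofPred_eq, not_and_or, not_forall, not_not] at hpr
    rcases hpr with ⟨i, -, hi⟩ | ⟨j, hj | hj⟩
    · exact htrans _ _ (by simpa using hi) (hRhalf i)
    · exact htrans _ _ hj (hRdelta j)
    · have := (hRdelta j).comp_affine (s := -1) (t := p + δ j) (by ring)
        (fun x => by rw [hRper _ _ hj, neg_one_mul, hRneg])
      simpa using this
  obtain ⟨c, hc⟩ := exists_const_of_periodic L hRpole hRper
  refine ⟨Function.update w (.inl ()) c, fun x hx => ?_⟩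
  have h1 := hc x (hRan x hx).continuousAt
  rw [hRx] at h1
  simp only [Fintype.sum_sum_type, Fintype.sum_sigma, basisFun, w, Sum.elim_inl, Sum.elim_inr,
    Function.update_apply]
  simp
  linear_combination h1

/-! ### Linearity of the third order operator -/

theorem deriv_lincomb {ι : Type*} [Fintype ι] {f : ι → ℂ → ℂ} (c : ι → ℂ) {x : ℂ}
    (hf : ∀ s, AnalyticAt ℂ (f s) x) :
    deriv (fun y => ∑ s, c s * f s y) =ᶠ[𝓝 x] fun y => ∑ s, c s * deriv (f s) y := by
  filter_upwards [eventually_all.2 fun s => (hf s).eventually_analyticAt] with y hy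
  exact (HasDerivAt.fun_sum fun s _ =>
    (hy s).differentiableAt.hasDerivAt.const_mul (c s)).deriv

theorem thirdOrder_lincomb {ι : Type*} [Fintype ι] (v : ℂ → ℂ) {f : ι → ℂ → ℂ} (c : ι → ℂ) {x : ℂ}
    (hf : ∀ s, AnalyticAt ℂ (f s) x) :
    thirdOrder v (fun y => ∑ s, c s * f s y) x = ∑ s, c s * thirdOrder v (f s) x := by
  have h1 := deriv_lincomb c hf
  have h2 := h1.deriv.trans (deriv_lincomb c fun s => (hf s).deriv)
  have h3 := h2.deriv.trans (deriv_lincomb c fun s => (hf s).deriv.deriv)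
  rw [thirdOrder, h3.eq_of_nhds, h1.eq_of_nhds, Finset.mul_sum, Finset.mul_sum,
    ← Finset.sum_sub_distrib, ← Finset.sum_sub_distrib]
  exact Finset.sum_congr rfl fun s _ => by rw [thirdOrder]; ring

theorem thirdOrder_congr (v : ℂ → ℂ) {f g : ℂ → ℂ} {x : ℂ} (h : f =ᶠ[𝓝 x] g) :
    thirdOrder v f x = thirdOrder v g x := by
  rw [thirdOrder, thirdOrder, h.deriv.deriv.deriv.eq_of_nhds, h.deriv.eq_of_nhds, h.eq_of_nhds]

/-! ### Polynomial solutions -/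

/-- The polynomials `P s` make `∑ P_s(E) φ_s(x)` a solution of `Ξ''' - 4 (v - E) Ξ' - 2 v' Ξ = 0`
on `U` with `P` monic in the component `o` and of lower degree in the others. -/
structure PolySolution {ι : Type*} [Fintype ι] (v : ℂ → ℂ) (U : Set ℂ) (φ : ι → ℂ → ℂ) (o : ι)
    (P : ι → ℂ[X]) : Prop where
  monic : (P o).Monic
  degree_lt : ∀ s, s ≠ o → (P s).degree < (P o).degree
  ode : ∀ x ∈ U, ∑ s, P s * (C (thirdOrder v (φ s) x) + C (4 * deriv (φ s) x) * X) = 0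

theorem PolySolution.of_mul {ι : Type*} [Fintype ι] {v : ℂ → ℂ} {U : Set ℂ} {φ : ι → ℂ → ℂ} {o : ι}
    {P Q : ι → ℂ[X]} {q : ℂ[X]} (h : PolySolution v U φ o P) (hq : q.Monic)
    (hP : ∀ s, P s = q * Q s) : PolySolution v U φ o Q where
  monic := hq.of_mul_monic_left (hP o ▸ h.monic)
  degree_lt s hs := by
    have := h.degree_lt s hs
    rw [hP, hP, degree_mul, degree_mul] at this
    exact lt_of_add_lt_add_left this
  ode x hx := by
    have := h.ode x hx
    simp only [hP, mul_assoc, ← Finset.mul_sum] at this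
    exact (mul_eq_zero.1 this).resolve_left hq.ne_zero

/-- A common factor, made monic, can be divided out of the equation; a solution whose monic
component has least degree therefore has only unit common factors. -/
theorem PolySolution.exists_coprime {ι : Type*} [Fintype ι] {v : ℂ → ℂ} {U : Set ℂ}
    {φ : ι → ℂ → ℂ} {o : ι} (h : ∃ P, PolySolution v U φ o P) :
    ∃ P, PolySolution v U φ o P ∧ ∀ q : ℂ[X], (∀ s, q ∣ P s) → IsUnit q := by
  obtain ⟨P, hP, hmin⟩ := exists_minimalFor_of_wellFoundedLT (PolySolution v U φ o)
    (fun P => (P o).natDegree) h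
  refine ⟨P, hP, fun q hq => ?_⟩
  have hq0 : q ≠ 0 := fun h0 => hP.monic.ne_zero (zero_dvd_iff.1 (h0 ▸ hq o))
  have hu : q.leadingCoeff ≠ 0 := leadingCoeff_ne_zero.2 hq0
  choose Q hQ using hq
  have hPQ : ∀ s, P s = (C q.leadingCoeff⁻¹ * q) * (C q.leadingCoeff * Q s) := fun s => by
    rw [hQ, show C q.leadingCoeff⁻¹ * q * (C q.leadingCoeff * Q s) =
      (C q.leadingCoeff⁻¹ * C q.leadingCoeff) * (q * Q s) by ring, ← C_mul, inv_mul_cancel₀ hu]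
    simp
  have hmonic : (C q.leadingCoeff⁻¹ * q).Monic := by
    rw [Monic, leadingCoeff_mul, leadingCoeff_C, inv_mul_cancel₀ hu]
  have hsol := hP.of_mul hmonic hPQ
  have hle := hmin hsol
  have hdeg : (P o).natDegree = (C q.leadingCoeff⁻¹ * q).natDegree +
      (C q.leadingCoeff * Q o).natDegree := by
    rw [hPQ o]; exact hmonic.natDegree_mul hsol.monic
  rw [natDegree_C_mul (inv_ne_zero hu)] at hdeg
  have h0 : q.natDegree = 0 := by
    have := hle (by simp only; omega)
    simp only at this
    omega
  rw [isUnit_iff_degree_eq_zero, degree_eq_natDegree hq0, h0]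
  rfl

/-- The linear map `X^m ↦ w m` from the infinite-dimensional `ℂ[X]` to `V` has a nonzero kernel. -/
theorem exists_monic_relation {V : Type*} [AddCommGroup V] [Module ℂ V] [FiniteDimensional ℂ V]
    (w : ℕ → V) : ∃ p : ℂ[X], p.Monic ∧ ∑ m ∈ Finset.range (p.natDegree + 1), p.coeff m • w m = 0 := by
  let T : ℂ[X] →ₗ[ℂ] V := Polynomial.lsum fun m => LinearMap.toSpanSingleton ℂ V (w m)
  have hT : ∀ p, T p = ∑ m ∈ Finset.range (p.natDegree + 1), p.coeff m • w m := fun p => by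
    simp [T, Polynomial.lsum_apply, Polynomial.sum_over_range]
  have hinj : ¬ Function.Injective T := fun h => by
    have := Module.Finite.of_injective T h
    exact Polynomial.not_finite this
  rw [← LinearMap.ker_eq_bot, Submodule.eq_bot_iff] at hinj
  push Not at hinj
  obtain ⟨q, hq, hq0⟩ := hinj
  have hu : q.leadingCoeff ≠ 0 := leadingCoeff_ne_zero.2 hq0
  refine ⟨C q.leadingCoeff⁻¹ * q, ?_, ?_⟩
  · rw [Monic, leadingCoeff_mul, leadingCoeff_C, inv_mul_cancel₀ hu]
  · rw [← hT, ← smul_eq_C_mul, map_smul, LinearMap.mem_ker.1 hq, smul_zero]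

theorem exists_polySolution {ι : Type*} [Fintype ι] {v : ℂ → ℂ} {U : Set ℂ} (hU : IsOpen U)
    {φ : ι → ℂ → ℂ} {o : ι} (hv : ∀ x ∈ U, AnalyticAt ℂ v x)
    (hφ : ∀ s, ∀ x ∈ U, AnalyticAt ℂ (φ s) x) (hφo : φ o = fun _ => 1)
    (ha : ∀ n, ∃ w : ι → ℂ, ∀ x ∈ U, formalCoeff v n x = ∑ s, w s * φ s x) :
    ∃ P, PolySolution v U φ o P := by
  classical
  -- The functions `φ s` are not assumed independent, so the coordinates of `a_0 = 1` are fixed by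
  -- choice. This makes the leading coefficients of `P` those of a unit vector.
  obtain ⟨w, hw0, hw⟩ : ∃ w : ℕ → ι → ℂ, w 0 = Pi.single o 1 ∧
      ∀ n, ∀ x ∈ U, formalCoeff v n x = ∑ s, w n s * φ s x := by
    choose w hw using ha
    refine ⟨Function.update w 0 (Pi.single o 1), by simp, fun n x hx => ?_⟩
    rcases n with _ | n
    · simp [formalCoeff_zero, Pi.single_apply, hφo]
    · simpa using hw (n + 1) x hx
  obtain ⟨p, hp, hpw⟩ := exists_monic_relation w
  obtain ⟨g, hg⟩ : ∃ g, p.natDegree = g + 1 := by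
    refine Nat.exists_eq_succ_of_ne_zero fun h => ?_
    have h1 := congrFun hpw o
    rw [h] at h1
    have h2 : p.coeff 0 = 1 := by rw [← h]; exact hp
    simp [h2, hw0] at h1
  have hpg : p.coeff (g + 1) = 1 := by rw [← hg]; exact hp
  rw [hg] at hpw
  -- The coordinates of the polynomial part of `E⁻¹ p(E) ∑ a_k E⁻ᵏ`.
  set P : ι → ℂ[X] := fun s => ∑ m ∈ Finset.range (g + 2), ∑ k ∈ Finset.range m,
    C (p.coeff m * w k s) * X ^ (m - 1 - k) with hP
  have hPdeg : ∀ s, (P s - C (w 0 s) * X ^ g).degree < (g : WithBot ℕ) := fun s => by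
    have e : P s - C (w 0 s) * X ^ g = ∑ m ∈ Finset.range (g + 1), ∑ k ∈ Finset.range m,
        C (p.coeff m * w k s) * X ^ (m - 1 - k) +
        ∑ k ∈ Finset.range g, C (w (k + 1) s) * X ^ (g - (k + 1)) := by
      simp only [hP]
      rw [Finset.sum_range_succ, Finset.sum_range_succ'
        (fun k => C (p.coeff (g + 1) * w k s) * X ^ (g + 1 - 1 - k)) g]
      simp [hpg]
      ring
    rw [e, ← mem_degreeLT]
    refine add_mem (sum_mem fun m hm => sum_mem fun k hk => ?_) (sum_mem fun k hk => ?_)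
    · rw [Finset.mem_range] at hm hk
      rw [mem_degreeLT]
      exact (degree_C_mul_X_pow_le _ _).trans_lt (by norm_cast; omega)
    · rw [Finset.mem_range] at hk
      rw [mem_degreeLT]
      exact (degree_C_mul_X_pow_le _ _).trans_lt (by norm_cast; omega)
  have hPo : P o = X ^ g + (P o - C (w 0 o) * X ^ g) := by simp [hw0]
  have hmonic : (P o).Monic := by
    rw [hPo]; exact monic_X_pow_add (hPdeg o)
  have hdeg : (P o).degree = g := by
    rw [hPo, degree_add_eq_left_of_degree_lt] <;> rw [degree_X_pow]
    exact hPdeg o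
  refine ⟨P, hmonic, fun s hs => ?_, fun x hx => ?_⟩
  · rw [hdeg]; simpa [hw0, hs] using hPdeg s
  have hlin : ∀ n, formalCoeff v n =ᶠ[𝓝 x] fun y => ∑ s, w n s * φ s y := fun n => by
    filter_upwards [hU.mem_nhds hx] with y hy using hw n y hy
  have hT : ∀ n, ∑ s, w n s * thirdOrder v (φ s) x = -4 * deriv (formalCoeff v (n + 1)) x :=
    fun n => by
      rw [← thirdOrder_lincomb v (w n) fun s => hφ s x hx, ← thirdOrder_congr v (hlin n),
        deriv_formalCoeff_succ (hv x hx)]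
      ring
  have hD : ∀ n, ∑ s, w n s * deriv (φ s) x = deriv (formalCoeff v n) x := fun n => by
    rw [(hlin n).deriv.eq_of_nhds, (deriv_lincomb (w n) fun s => hφ s x hx).eq_of_nhds]
  set D : ℕ → ℂ := fun n => deriv (formalCoeff v n) x with hDdef
  have hD0 : D 0 = 0 := by simp [hDdef, formalCoeff_zero]
  have hsum : ∑ m ∈ Finset.range (g + 2), p.coeff m * D m = 0 := by
    simp only [hDdef, ← hD, Finset.mul_sum]
    rw [Finset.sum_comm]
    refine Finset.sum_eq_zero fun s _ => ?_
    have := congrFun hpw s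
    simp only [Finset.sum_apply, Pi.smul_apply, smul_eq_mul, Pi.zero_apply] at this
    simp only [← mul_assoc, ← Finset.sum_mul]
    rw [this, zero_mul]
  -- By the recursion, `a_k E^(m-1-k)` is sent to `4 (a_k' E^(m-k) - a_{k+1}' E^(m-k-1))`. Summation
  -- over `k < m` leaves `-4 a_m'`, as `a_0' = 0`, and the relation `p` kills the sum over `m`.
  calc ∑ s, P s * (C (thirdOrder v (φ s) x) + C (4 * deriv (φ s) x) * X)
      = ∑ m ∈ Finset.range (g + 2), ∑ k ∈ Finset.range m, C (p.coeff m) * X ^ (m - 1 - k) *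
          (C (∑ s, w k s * thirdOrder v (φ s) x) + C (4 * ∑ s, w k s * deriv (φ s) x) * X) := by
        simp only [hP, Finset.sum_mul]
        rw [Finset.sum_comm]
        refine Finset.sum_congr rfl fun m _ => ?_
        rw [Finset.sum_comm]
        refine Finset.sum_congr rfl fun k _ => ?_
        simp only [map_sum, map_mul, Finset.mul_sum, Finset.sum_mul, ← Finset.sum_add_distrib]
        exact Finset.sum_congr rfl fun s _ => by ring
    _ = ∑ m ∈ Finset.range (g + 2), ∑ k ∈ Finset.range m, C (4 * p.coeff m) *
          (X ^ (m - k) * C (D k) - X ^ (m - (k + 1)) * C (D (k + 1))) := by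
        refine Finset.sum_congr rfl fun m _ => Finset.sum_congr rfl fun k hk => ?_
        rw [Finset.mem_range] at hk
        rw [hT, hD, show m - 1 - k = m - (k + 1) by omega,
          show m - k = m - (k + 1) + 1 by omega]
        simp only [map_mul, map_neg, pow_succ, hDdef]
        ring
    _ = ∑ m ∈ Finset.range (g + 2), C (-4 * (p.coeff m * D m)) := by
        refine Finset.sum_congr rfl fun m _ => ?_
        rw [← Finset.mul_sum, Finset.sum_range_sub' (fun k => X ^ (m - k) * C (D k)) m]
        simp only [hD0, map_zero, map_mul, map_neg, Nat.sub_self, pow_zero]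
        ring
    _ = 0 := by rw [← map_sum, ← Finset.mul_sum, hsum]; simp

/-! ### From polynomial solutions to `xi` -/

theorem xi_eq_sum (L : PeriodPair) (l : Fin 4 → ℕ) {M : ℕ} (δ : Fin M → ℂ)
    (P : BasisIndex l M → ℂ[X]) (x : ℂ) :
    xi L l δ (P (.inl ())) (fun i j => P (.inr (.inl ⟨i, j⟩))) (fun j => P (.inr (.inr j))) x =
      ∑ s, C (basisFun L l δ s x) * P s := by
  simp only [xi, Fintype.sum_sum_type, Fintype.sum_sigma, basisFun]
  simp [add_assoc]

theorem isXi_of_polySolution {L : PeriodPair} {l : Fin 4 → ℕ} {M : ℕ} {δ : Fin M → ℂ}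
    {P : BasisIndex l M → ℂ[X]}
    (hU : ∀ x, AnalyticAt ℂ (potential L l δ) x → x ∈ regularSet L l δ)
    (hP : PolySolution (potential L l δ) (regularSet L l δ) (basisFun L l δ) (.inl ()) P)
    (hc : ∀ q : ℂ[X], (∀ s, q ∣ P s) → IsUnit q) :
    IsXi L l δ (P (.inl ())) (fun i j => P (.inr (.inl ⟨i, j⟩))) (fun j => P (.inr (.inr j))) where
  monic := hP.monic
  degree_b i j := hP.degree_lt _ (by simp)
  degree_d j := hP.degree_lt _ (by simp)
  coprime q h1 h2 h3 := hc q (by rintro (_ | ⟨i, j⟩ | j); exacts [h1, h2 i j, h3 j])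
  periodic x w hw := by simp only [xi_eq_sum, basisFun_add L l δ _ x hw]
  ode E x hx := by
    have hφ := fun s => analyticAt_basisFun s (hU x hx)
    have e : (fun y => (xi L l δ (P (.inl ())) (fun i j => P (.inr (.inl ⟨i, j⟩)))
        (fun j => P (.inr (.inr j))) y).eval E) =
        fun y => ∑ s, (P s).eval E * basisFun L l δ s y := by
      funext y
      rw [xi_eq_sum, eval_finsetSum]
      exact Finset.sum_congr rfl fun s _ => by rw [eval_mul, eval_C, mul_comm]
    have h1 := thirdOrder_lincomb (potential L l δ) (fun s => (P s).eval E) hφ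
    have h2 := (deriv_lincomb (fun s => (P s).eval E) hφ).eq_of_nhds
    have h3 := congrArg (eval E) (hP.ode x (hU x hx))
    simp only [eval_finsetSum, eval_mul, eval_add, eval_C, eval_X, eval_zero, mul_add,
      Finset.sum_add_distrib] at h3
    rw [← h1] at h3
    have h4 : ∑ s, (P s).eval E * (4 * deriv (basisFun L l δ s) x * E) =
        4 * E * ∑ s, (P s).eval E * deriv (basisFun L l δ s) x := by
      rw [Finset.mul_sum]; exact Finset.sum_congr rfl fun s _ => by ring
    rw [h4, ← h2, thirdOrder] at h3
    rw [congrFun e x, e, iteratedDeriv_succ, iteratedDeriv_succ, iteratedDeriv_one]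
    linear_combination h3

/-! ### Differential operators -/

/-- `c` is meromorphic, and holomorphic wherever `q` is. -/
def RegularWith (q c : ℂ → ℂ) : Prop :=
  Meromorphic c ∧ ∀ x, AnalyticAt ℂ q x → AnalyticAt ℂ c x

theorem RegularWith.zero (q : ℂ → ℂ) : RegularWith q fun _ => 0 :=
  ⟨Meromorphic.const _, fun _ _ => analyticAt_const⟩

theorem RegularWith.const (q : ℂ → ℂ) (a : ℂ) : RegularWith q fun _ => a :=
  ⟨Meromorphic.const _, fun _ _ => analyticAt_const⟩

theorem RegularWith.add {q c d : ℂ → ℂ} (hc : RegularWith q c) (hd : RegularWith q d) :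
    RegularWith q fun x => c x + d x :=
  ⟨hc.1.fun_add hd.1, fun x hx => (hc.2 x hx).add (hd.2 x hx)⟩

theorem RegularWith.mul {q c d : ℂ → ℂ} (hc : RegularWith q c) (hd : RegularWith q d) :
    RegularWith q fun x => c x * d x :=
  ⟨hc.1.fun_mul hd.1, fun x hx => (hc.2 x hx).mul (hd.2 x hx)⟩

theorem RegularWith.deriv {q c : ℂ → ℂ} (hc : RegularWith q c) : RegularWith q (deriv c) :=
  ⟨hc.1.deriv, fun x hx => (hc.2 x hx).deriv⟩

/-- `T` acts on germs at the regular points of `q` as a differential operator of order less than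
`n` with coefficients regular with `q`. -/
def IsDiffOp (q : ℂ → ℂ) (n : ℕ) (T : (ℂ → ℂ) → ℂ → ℂ) : Prop :=
  ∃ c : ℕ → ℂ → ℂ, (∀ k, RegularWith q (c k)) ∧ ∀ f x, AnalyticAt ℂ q x → AnalyticAt ℂ f x →
    T f x = ∑ k ∈ Finset.range n, c k x * iteratedDeriv k f x

theorem IsDiffOp.congr {q : ℂ → ℂ} {n : ℕ} {S T : (ℂ → ℂ) → ℂ → ℂ} (hT : IsDiffOp q n T)
    (h : ∀ f x, AnalyticAt ℂ q x → AnalyticAt ℂ f x → S f x = T f x) : IsDiffOp q n S := by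
  obtain ⟨c, hc, hT⟩ := hT
  exact ⟨c, hc, fun f x hq hf => by rw [h f x hq hf, hT f x hq hf]⟩

theorem IsDiffOp.zero (q : ℂ → ℂ) (n : ℕ) : IsDiffOp q n fun _ _ => 0 :=
  ⟨fun _ _ => 0, fun _ => RegularWith.zero q, by simp⟩

theorem IsDiffOp.iteratedDeriv (q : ℂ → ℂ) {k n : ℕ} (hk : k < n) :
    IsDiffOp q n fun f => iteratedDeriv k f := by
  refine ⟨fun m _ => if m = k then 1 else 0, fun m => RegularWith.const q _, fun f x _ _ => ?_⟩
  simp [hk]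

theorem IsDiffOp.mono {q : ℂ → ℂ} {m n : ℕ} {T : (ℂ → ℂ) → ℂ → ℂ} (hT : IsDiffOp q m T)
    (hmn : m ≤ n) : IsDiffOp q n T := by
  obtain ⟨c, hc, hT⟩ := hT
  refine ⟨fun k => if k < m then c k else fun _ => 0, fun k => ?_, fun f x hq hf => ?_⟩
  · dsimp only
    split_ifs
    exacts [hc k, RegularWith.zero q]
  · rw [hT f x hq hf]
    refine Finset.sum_subset_zero_on_sdiff (by simpa using hmn) (fun k hk => ?_) fun k hk => ?_
    · have : ¬ k < m := by simpa using (Finset.mem_sdiff.1 hk).2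
      simp [this]
    · simp [Finset.mem_range.1 hk]

theorem IsDiffOp.add {q : ℂ → ℂ} {n : ℕ} {S T : (ℂ → ℂ) → ℂ → ℂ} (hS : IsDiffOp q n S)
    (hT : IsDiffOp q n T) : IsDiffOp q n fun f x => S f x + T f x := by
  obtain ⟨c, hc, hS⟩ := hS
  obtain ⟨d, hd, hT⟩ := hT
  refine ⟨fun k x => c k x + d k x, fun k => (hc k).add (hd k), fun f x hq hf => ?_⟩
  dsimp only
  rw [hS f x hq hf, hT f x hq hf, ← Finset.sum_add_distrib]
  exact Finset.sum_congr rfl fun k _ => by ring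

theorem IsDiffOp.mul {q a : ℂ → ℂ} {n : ℕ} {T : (ℂ → ℂ) → ℂ → ℂ} (ha : RegularWith q a)
    (hT : IsDiffOp q n T) : IsDiffOp q n fun f x => a x * T f x := by
  obtain ⟨d, hd, hT⟩ := hT
  refine ⟨fun k x => a x * d k x, fun k => ha.mul (hd k), fun f x hq hf => ?_⟩
  dsimp only
  rw [hT f x hq hf, Finset.mul_sum]
  exact Finset.sum_congr rfl fun k _ => by ring

theorem IsDiffOp.sum {q : ℂ → ℂ} {n : ℕ} {ι : Type*} (s : Finset ι) {T : ι → (ℂ → ℂ) → ℂ → ℂ}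
    (hT : ∀ i ∈ s, IsDiffOp q n (T i)) : IsDiffOp q n fun f x => ∑ i ∈ s, T i f x := by
  classical
  induction s using Finset.induction_on with
  | empty => simpa using IsDiffOp.zero q n
  | insert i s hi ih =>
    simp only [Finset.sum_insert hi]
    exact (hT i (by simp)).add (ih fun j hj => hT j (by simp [hj]))

theorem IsDiffOp.deriv {q : ℂ → ℂ} {n : ℕ} {T : (ℂ → ℂ) → ℂ → ℂ} (hT : IsDiffOp q n T) :
    IsDiffOp q (n + 1) fun f => deriv (T f) := by
  obtain ⟨c, hc, hT⟩ := hT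
  have h1 : IsDiffOp q n fun f x => ∑ k ∈ Finset.range n, _root_.deriv (c k) x *
      _root_.iteratedDeriv k f x :=
    ⟨_, fun k => (hc k).deriv, fun f x _ _ => rfl⟩
  have h2 : IsDiffOp q (n + 1) fun f x => ∑ k ∈ Finset.range n, c k x *
      _root_.iteratedDeriv (k + 1) f x := by
    refine ⟨fun k => Nat.casesOn k (fun _ => 0) c, fun k => ?_, fun f x _ _ => ?_⟩
    · rcases k with _ | k
      exacts [RegularWith.zero q, hc k]
    · rw [Finset.sum_range_succ']
      simp
  refine ((h1.mono n.le_succ).add h2).congr fun f x hq hf => ?_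
  have he : T f =ᶠ[𝓝 x] fun y => ∑ k ∈ Finset.range n, c k y * _root_.iteratedDeriv k f y := by
    filter_upwards [hq.eventually_analyticAt, hf.eventually_analyticAt] with y h1 h2
      using hT f y h1 h2
  rw [he.deriv_eq, ← Finset.sum_add_distrib]
  refine (HasDerivAt.fun_sum fun k _ => ?_).deriv
  have hk := (hf.iterated_deriv k).differentiableAt.hasDerivAt
  rw [← iteratedDeriv_eq_iterate, ← iteratedDeriv_succ] at hk
  exact ((hc k).2 x hq).differentiableAt.hasDerivAt.mul hk

theorem schrodinger_eq (q f : ℂ → ℂ) (x : ℂ) :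
    schrodinger q f x = -deriv (deriv f) x + q x * f x := by
  rw [schrodinger, iteratedDeriv_succ, iteratedDeriv_one]

theorem analyticAt_schrodinger {q f : ℂ → ℂ} {x : ℂ} (hq : AnalyticAt ℂ q x)
    (hf : AnalyticAt ℂ f x) : AnalyticAt ℂ (schrodinger q f) x := by
  have h1 := hf.deriv.deriv
  rw [funext (schrodinger_eq q f)]
  fun_prop

theorem analyticAt_schrodinger_iterate {q f : ℂ → ℂ} {x : ℂ} (hq : AnalyticAt ℂ q x)
    (hf : AnalyticAt ℂ f x) (i : ℕ) : AnalyticAt ℂ ((schrodinger q)^[i] f) x := by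
  induction i with
  | zero => exact hf
  | succ i ih => rw [Function.iterate_succ_apply']; exact analyticAt_schrodinger hq ih

theorem schrodinger_congr {q f g : ℂ → ℂ} {x : ℂ} (h : f =ᶠ[𝓝 x] g) :
    schrodinger q f x = schrodinger q g x := by
  rw [schrodinger_eq, schrodinger_eq, h.deriv.deriv_eq, h.eq_of_nhds]

theorem schrodinger_const_mul (q f : ℂ → ℂ) (a x : ℂ) :
    schrodinger q (fun y => a * f y) x = a * schrodinger q f x := by
  have h : deriv (fun y => a * f y) = fun y => a * deriv f y :=
    funext fun y => deriv_const_mul_field a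
  rw [schrodinger_eq, schrodinger_eq, h, deriv_const_mul_field]
  ring

/-- Removing the leading term of `H^(i+1)` lowers the order by two, not one: the next coefficient is
zero. This is why `(d/dx)^(2g)` is missing from the final operator. -/
theorem isDiffOp_schrodinger_iterate_sub_leading {q : ℂ → ℂ} (hqm : Meromorphic q) (i : ℕ) :
    IsDiffOp q (2 * i + 1) fun f x =>
      (schrodinger q)^[i + 1] f x - (-1) ^ (i + 1) * iteratedDeriv (2 * (i + 1)) f x := by
  have hq : RegularWith q q := ⟨hqm, fun _ h => h⟩
  induction i with
  | zero =>
    refine (IsDiffOp.mul hq (IsDiffOp.iteratedDeriv q (k := 0) (n := 1) one_pos)).congr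
      fun f x _ _ => ?_
    simp [schrodinger]
  | succ i ih =>
    have h1 := (IsDiffOp.mul (RegularWith.const q (-1)) ih.deriv.deriv).add
      (IsDiffOp.mul hq ((ih.mono (n := 2 * i + 1 + 1 + 1) (by omega)).add
        (IsDiffOp.mul (RegularWith.const q ((-1) ^ (i + 1)))
          (IsDiffOp.iteratedDeriv q (k := 2 * (i + 1)) (n := 2 * i + 1 + 1 + 1) (by omega)))))
    refine h1.congr fun f x hqx hf => ?_
    have hF : ∀ᶠ y in 𝓝 x, AnalyticAt ℂ ((schrodinger q)^[i + 1] f) y ∧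
        AnalyticAt ℂ (iteratedDeriv (2 * (i + 1)) f) y := by
      filter_upwards [hqx.eventually_analyticAt, hf.eventually_analyticAt] with y h1 h2
      refine ⟨analyticAt_schrodinger_iterate h1 h2 _, ?_⟩
      rw [iteratedDeriv_eq_iterate]; exact h2.iterated_deriv _
    have hd : deriv (fun x => (schrodinger q)^[i + 1] f x -
        (-1) ^ (i + 1) * iteratedDeriv (2 * (i + 1)) f x) =ᶠ[𝓝 x]
        fun y => deriv ((schrodinger q)^[i + 1] f) y -
          (-1) ^ (i + 1) * deriv (iteratedDeriv (2 * (i + 1)) f) y := by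
      filter_upwards [hF] with y hy
      exact (hy.1.differentiableAt.hasDerivAt.sub
        (hy.2.differentiableAt.hasDerivAt.const_mul _)).deriv
    have hd2 := (hF.self_of_nhds.1.deriv.differentiableAt.hasDerivAt.sub
      (hF.self_of_nhds.2.deriv.differentiableAt.hasDerivAt.const_mul ((-1) ^ (i + 1)))).deriv
    have hd3 := hd.deriv_eq.trans hd2
    have h4 : iteratedDeriv (2 * (i + 1 + 1)) f x =
        deriv (deriv (iteratedDeriv (2 * (i + 1)) f)) x := by
      rw [show 2 * (i + 1 + 1) = 2 * (i + 1) + 1 + 1 by ring, iteratedDeriv_succ, iteratedDeriv_succ]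
    rw [hd3, Function.iterate_succ_apply', schrodinger_eq, h4]
    ring

/-! ### The operator built from a polynomial solution -/

/-- `∑_{i ≤ g} (e_i d/dx - e_i'/2) H^i`. -/
noncomputable def hierarchyOperator (q : ℂ → ℂ) (g : ℕ) (e : ℕ → ℂ → ℂ) (f : ℂ → ℂ) (x : ℂ) : ℂ :=
  ∑ i ∈ Finset.range (g + 1), (e i x * deriv ((schrodinger q)^[i] f) x
    - 1 / 2 * deriv (e i) x * (schrodinger q)^[i] f x)

theorem operatorOf_eq_hierarchyOperator (q : ℂ → ℂ) (g : ℕ) (P : ℂ → ℂ[X]) (f : ℂ → ℂ) (x : ℂ) :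
    operatorOf q g P f x = hierarchyOperator q g (fun i y => (P y).coeff i) f x := by
  rw [operatorOf, hierarchyOperator, ← Finset.sum_range_reflect]
  exact Finset.sum_congr rfl fun i hi => by
    have : i < g + 1 := Finset.mem_range.1 hi
    simp only [show g + 1 - 1 - i = g - i by omega, show g - (g - i) = i by omega]

theorem isDiffOp_schrodinger_iterate {q : ℂ → ℂ} (hqm : Meromorphic q) (i : ℕ) :
    IsDiffOp q (2 * i + 1) fun f x => (schrodinger q)^[i] f x := by
  rcases i with _ | i
  · exact (IsDiffOp.iteratedDeriv q (k := 0) one_pos).congr fun f x _ _ => by simp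
  · refine (((isDiffOp_schrodinger_iterate_sub_leading hqm i).mono (n := 2 * (i + 1) + 1) (by omega)).add
      (IsDiffOp.mul (RegularWith.const q ((-1) ^ (i + 1))) (IsDiffOp.iteratedDeriv q
        (k := 2 * (i + 1)) (by omega)))).congr fun f x _ _ => by ring

/-- As `e_g = 1`, the top summand is `d/dx ∘ H^g`, equal to `(-1)^g (d/dx)^(2g+1)` up to order `2g -
1`; the summands with `i < g` also have order at most `2g - 1`. -/
theorem exists_oddOperator_eq {q : ℂ → ℂ} (hqm : Meromorphic q) {g : ℕ} {e : ℕ → ℂ → ℂ}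
    (he : ∀ i, RegularWith q (e i)) (heg : e g = fun _ => 1) :
    ∃ B : Fin (2 * g) → ℂ → ℂ, (∀ j, RegularWith q (B j)) ∧
      ∀ f x, AnalyticAt ℂ q x → AnalyticAt ℂ f x →
        oddOperator g B f x = (-1) ^ g * hierarchyOperator q g e f x := by
  have hlow : IsDiffOp q (2 * g) fun f x =>
      (-1) ^ g * hierarchyOperator q g e f x - iteratedDeriv (2 * g + 1) f x := by
    have h1 : IsDiffOp q (2 * g) fun f x => ∑ i ∈ Finset.range g,
        (e i x * deriv ((schrodinger q)^[i] f) x +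
          (-(1 / 2) * deriv (e i) x) * (schrodinger q)^[i] f x) := by
      refine IsDiffOp.sum _ fun i hi => ?_
      have hi : i < g := Finset.mem_range.1 hi
      have h0 := isDiffOp_schrodinger_iterate hqm i
      exact (IsDiffOp.mul (he i) (h0.deriv.mono (by omega))).add
        (IsDiffOp.mul ((RegularWith.const q _).mul (he i).deriv) (h0.mono (by omega)))
    have h2 : IsDiffOp q (2 * g) fun f x =>
        (-1) ^ g * deriv ((schrodinger q)^[g] f) x - iteratedDeriv (2 * g + 1) f x := by
      rcases g with _ | g
      · exact (IsDiffOp.zero q _).congr fun f x _ _ => by simp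
      · refine ((IsDiffOp.mul (RegularWith.const q ((-1) ^ (g + 1)))
          (isDiffOp_schrodinger_iterate_sub_leading hqm g).deriv)).congr fun f x hqx hf => ?_
        have hF := analyticAt_schrodinger_iterate hqx hf (g + 1)
        have hI : AnalyticAt ℂ (iteratedDeriv (2 * (g + 1)) f) x := by
          rw [iteratedDeriv_eq_iterate]; exact hf.iterated_deriv _
        have hd := (hF.differentiableAt.hasDerivAt.sub
          (hI.differentiableAt.hasDerivAt.const_mul ((-1) ^ (g + 1)))).deriv
        have hd' : deriv (fun x => (schrodinger q)^[g + 1] f x -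
            (-1) ^ (g + 1) * iteratedDeriv (2 * (g + 1)) f x) x = _ := hd
        rw [hd', iteratedDeriv_succ (n := 2 * (g + 1))]
        have : ((-1 : ℂ) ^ (g + 1)) * (-1) ^ (g + 1) = 1 := by
          rw [← mul_pow]; simp
        linear_combination deriv (iteratedDeriv (2 * (g + 1)) f) x * this
    refine ((IsDiffOp.mul (RegularWith.const q ((-1) ^ g)) h1).add h2).congr fun f x _ _ => ?_
    rw [hierarchyOperator, Finset.sum_range_succ, heg]
    simp only [deriv_const, mul_zero, zero_mul, sub_zero, one_mul, neg_mul, ← sub_eq_add_neg]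
    ring
  obtain ⟨c, hc, hcx⟩ := hlow
  refine ⟨fun j => c (2 * g - 1 - j), fun j => hc _, fun f x hq hf => ?_⟩
  have := hcx f x hq hf
  rw [oddOperator, Fin.sum_univ_eq_sum_range
    (fun j => c (2 * g - 1 - j) x * iteratedDeriv (2 * g - 1 - j) f x) (2 * g),
    Finset.sum_range_reflect (fun j => c j x * iteratedDeriv j f x) (2 * g), ← this]
  ring

/-- One has `[e d/dx - e'/2, H] = -2 e' H - (1/2) T e`, where `T` is `thirdOrder q`. The hypotheses
on `T e_i` turn the sum of these against `H^i` into a telescoping one. -/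
theorem hierarchyOperator_comm {q : ℂ → ℂ} {g : ℕ} {e : ℕ → ℂ → ℂ} {f : ℂ → ℂ} {x : ℂ}
    (hq : AnalyticAt ℂ q x) (he : ∀ i, AnalyticAt ℂ (e i) x) (heg : e g = fun _ => 1)
    (h0 : thirdOrder q (e 0) x = 0) (hrec : ∀ i, thirdOrder q (e (i + 1)) x = -4 * deriv (e i) x)
    (hf : AnalyticAt ℂ f x) :
    hierarchyOperator q g e (schrodinger q f) x = schrodinger q (hierarchyOperator q g e f) x := by
  set F : ℕ → ℂ → ℂ := fun i => (schrodinger q)^[i] f with hF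
  have hFa : ∀ i, AnalyticAt ℂ (F i) x := fun i => analyticAt_schrodinger_iterate hq hf i
  have hFs : ∀ i, F (i + 1) = fun y => -deriv (deriv (F i)) y + q y * F i y := fun i => by
    funext y
    simp only [hF]
    rw [Function.iterate_succ_apply', schrodinger_eq]
  have hFd : ∀ i, deriv (F (i + 1)) x =
      -deriv (deriv (deriv (F i))) x + (deriv q x * F i x + q x * deriv (F i) x) := fun i => by
    rw [hFs]
    exact ((hFa i).deriv.deriv.differentiableAt.hasDerivAt.neg.add
      (hq.differentiableAt.hasDerivAt.mul (hFa i).differentiableAt.hasDerivAt)).deriv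
  have hL : hierarchyOperator q g e (schrodinger q f) x = ∑ i ∈ Finset.range (g + 1),
      (e i x * deriv (F (i + 1)) x - 1 / 2 * deriv (e i) x * F (i + 1) x) := rfl
  have hd1 : deriv (hierarchyOperator q g e f) =ᶠ[𝓝 x] fun y => ∑ i ∈ Finset.range (g + 1),
      (1 / 2 * (deriv (e i) y * deriv (F i) y) + e i y * deriv (deriv (F i)) y -
        1 / 2 * (deriv (deriv (e i)) y * F i y)) := by
    filter_upwards [(Finset.range (g + 1)).eventually_all.2 fun i _ => (he i).eventually_analyticAt,
      (Finset.range (g + 1)).eventually_all.2 fun i _ => (hFa i).eventually_analyticAt] with y h1 h2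
    refine (HasDerivAt.fun_sum (A' := fun i => 1 / 2 * (deriv (e i) y * deriv (F i) y) +
      e i y * deriv (deriv (F i)) y - 1 / 2 * (deriv (deriv (e i)) y * F i y)) fun i hi => ?_).deriv
    have := ((h1 i hi).differentiableAt.hasDerivAt.mul
      (h2 i hi).deriv.differentiableAt.hasDerivAt).sub
      (((h1 i hi).deriv.differentiableAt.hasDerivAt.const_mul (1 / 2)).mul
        (h2 i hi).differentiableAt.hasDerivAt)
    convert! this using 1
    ring
  have hd2 : deriv (deriv (hierarchyOperator q g e f)) x = ∑ i ∈ Finset.range (g + 1),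
      (3 / 2 * (deriv (e i) x * deriv (deriv (F i)) x) + e i x * deriv (deriv (deriv (F i))) x -
        1 / 2 * (deriv (deriv (deriv (e i))) x * F i x)) := by
    rw [hd1.deriv_eq]
    refine (HasDerivAt.fun_sum fun i _ => ?_).deriv
    have h1 := (he i).differentiableAt.hasDerivAt
    have h2 := (he i).deriv.differentiableAt.hasDerivAt
    have h3 := (he i).deriv.deriv.differentiableAt.hasDerivAt
    have k1 := (hFa i).differentiableAt.hasDerivAt
    have k2 := (hFa i).deriv.differentiableAt.hasDerivAt
    have k3 := (hFa i).deriv.deriv.differentiableAt.hasDerivAt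
    have := (((h2.mul k2).const_mul (1 / 2)).add (h1.mul k3)).sub ((h3.mul k1).const_mul (1 / 2))
    convert! this using 1
    ring
  -- The telescoping quantity: the `i`-th commutator is `G i - G (i + 1)`. The lower end vanishes by
  -- `h0`, the upper because `e_g` is constant.
  set G : ℕ → ℂ := fun i => Nat.casesOn i 0 fun i => 2 * deriv (e i) x * F (i + 1) x with hG
  have hT : ∀ i, -(1 / 2) * thirdOrder q (e i) x * F i x = G i := fun i => by
    rcases i with _ | i
    · simp [hG, h0]
    · simp only [hG, hrec]; ring
  have hsum : ∑ i ∈ Finset.range (g + 1), (G i - G (i + 1)) = 0 := by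
    rw [Finset.sum_range_sub']
    simp [hG, heg]
  rw [hL, schrodinger_eq, hd2, hierarchyOperator, ← sub_eq_zero, ← hsum, Finset.mul_sum,
    ← Finset.sum_neg_distrib, ← Finset.sum_add_distrib, ← Finset.sum_sub_distrib]
  refine Finset.sum_congr rfl fun i _ => ?_
  rw [← hT i, thirdOrder, hFd]
  simp only [hG]
  have := congrFun (hFs i) x
  simp only [hF] at this ⊢
  rw [this]
  ring

theorem commutesWithSchrodinger_of_eq {q : ℂ → ℂ} {g : ℕ} {e : ℕ → ℂ → ℂ}
    {B : Fin (2 * g) → ℂ → ℂ} (he : ∀ i, RegularWith q (e i)) (heg : e g = fun _ => 1)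
    (h0 : ∀ x, AnalyticAt ℂ q x → thirdOrder q (e 0) x = 0)
    (hrec : ∀ x, AnalyticAt ℂ q x → ∀ i, thirdOrder q (e (i + 1)) x = -4 * deriv (e i) x)
    (hB : ∀ j, RegularWith q (B j))
    (hBe : ∀ f x, AnalyticAt ℂ q x → AnalyticAt ℂ f x →
        oddOperator g B f x = (-1) ^ g * hierarchyOperator q g e f x) :
    CommutesWithSchrodinger q g B := by
  refine ⟨fun j => (hB j).1, fun j => (hB j).2, fun f x hq hf => ?_⟩
  have hev : oddOperator g B f =ᶠ[𝓝 x] fun y => (-1) ^ g * hierarchyOperator q g e f y := by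
    filter_upwards [hq.eventually_analyticAt, hf.eventually_analyticAt] with y h1 h2
      using hBe f y h1 h2
  rw [hBe _ x hq (analyticAt_schrodinger hq hf), schrodinger_congr hev, schrodinger_const_mul,
    hierarchyOperator_comm hq (fun i => (he i).2 x hq) heg (h0 x hq) (hrec x hq) hf]

/-! ### The main theorem -/

theorem isOpen_regularSet {L : PeriodPair} {l : Fin 4 → ℕ} {M : ℕ} {δ : Fin M → ℂ}
    (h : ∀ x, AnalyticAt ℂ (potential L l δ) x ↔ x ∈ regularSet L l δ) :
    IsOpen (regularSet L l δ) := by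
  have : regularSet L l δ = {x | AnalyticAt ℂ (potential L l δ) x} := Set.ext fun x => (h x).symm
  rw [this]
  exact isOpen_analyticAt ℂ _

theorem coeff_sum_C_mul {ι : Type*} [Fintype ι] (φ : ι → ℂ) (P : ι → ℂ[X]) (n : ℕ) :
    (∑ s, C (φ s) * P s).coeff n = ∑ s, (P s).coeff n * φ s := by
  rw [finsetSum_coeff]
  exact Finset.sum_congr rfl fun s _ => by rw [coeff_C_mul, mul_comm]

theorem PolySolution.coeff_natDegree {ι : Type*} [Fintype ι] {v : ℂ → ℂ} {U : Set ℂ}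
    {φ : ι → ℂ → ℂ} {o : ι} {P : ι → ℂ[X]} (h : PolySolution v U φ o P) (hφo : φ o = fun _ => 1)
    (x : ℂ) : ∑ s, (P s).coeff (P o).natDegree * φ s x = 1 := by
  rw [Finset.sum_eq_single o, hφo, h.monic.coeff_natDegree, mul_one]
  · intro s _ hs
    rw [coeff_eq_zero_of_degree_lt, zero_mul]
    rw [← degree_eq_natDegree h.monic.ne_zero]
    exact h.degree_lt s hs
  · simp

theorem PolySolution.thirdOrder_coeff_zero {ι : Type*} [Fintype ι] {v : ℂ → ℂ} {U : Set ℂ}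
    {φ : ι → ℂ → ℂ} {o : ι} {P : ι → ℂ[X]} (h : PolySolution v U φ o P) {x : ℂ} (hx : x ∈ U)
    (hφ : ∀ s, AnalyticAt ℂ (φ s) x) :
    thirdOrder v (fun y => ∑ s, (P s).coeff 0 * φ s y) x = 0 := by
  have := congrArg (fun p => coeff p 0) (h.ode x hx)
  simp only [finsetSum_coeff, mul_add, coeff_add, coeff_mul_C, ← mul_assoc, coeff_mul_X_zero,
    add_zero, coeff_zero] at this
  rw [thirdOrder_lincomb v _ hφ, this]

/-- The coefficient of `E^(n+1)` in the equation for `Ξ`. -/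
theorem PolySolution.thirdOrder_coeff_succ {ι : Type*} [Fintype ι] {v : ℂ → ℂ} {U : Set ℂ}
    {φ : ι → ℂ → ℂ} {o : ι} {P : ι → ℂ[X]} (h : PolySolution v U φ o P) {x : ℂ} (hx : x ∈ U)
    (hφ : ∀ s, AnalyticAt ℂ (φ s) x) (n : ℕ) :
    thirdOrder v (fun y => ∑ s, (P s).coeff (n + 1) * φ s y) x =
      -4 * deriv (fun y => ∑ s, (P s).coeff n * φ s y) x := by
  have := congrArg (fun p => coeff p (n + 1)) (h.ode x hx)
  simp only [finsetSum_coeff, mul_add, coeff_add, coeff_mul_C, ← mul_assoc, coeff_mul_X,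
    coeff_zero, Finset.sum_add_distrib] at this
  rw [thirdOrder_lincomb v _ hφ, (deriv_lincomb _ hφ).eq_of_nhds, Finset.mul_sum,
    eq_neg_of_add_eq_zero_left this, ← Finset.sum_neg_distrib]
  exact Finset.sum_congr rfl fun s _ => by ring

end FiniteGap

open FiniteGap in
theorem mainTheorem1 (L : PeriodPair) (M : ℕ) (l : Fin 4 → ℕ) (δ : Fin M → ℂ)
    (hδ : ∀ j i, δ j - FiniteGap.halfPeriod L i ∉ L.lattice)
    (hδδ : ∀ j j', j < j' → δ j - δ j' ∉ L.lattice ∧ δ j + δ j' ∉ L.lattice)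
    (heq : ∀ j, 2 * ∑ j' ∈ Finset.univ.erase j,
          (L.derivWeierstrassP (δ j - δ j') + L.derivWeierstrassP (δ j + δ j')) +
        ∑ i : Fin 4, ((l i : ℂ) + 1 / 2) ^ 2 *
          L.derivWeierstrassP (δ j + FiniteGap.halfPeriod L i) = 0) :
    FiniteGap.IsAlgebroGeometricFiniteGap (FiniteGap.potential L l δ) ∧
    ∃ (c : Polynomial ℂ) (b : (i : Fin 4) → Fin (l i) → Polynomial ℂ) (d : Fin M → Polynomial ℂ),
      FiniteGap.IsXi L l δ c b d ∧
      ∃ B : Fin (2 * c.natDegree) → ℂ → ℂ,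
        FiniteGap.CommutesWithSchrodinger (FiniteGap.potential L l δ) c.natDegree B ∧
        ∀ (f : ℂ → ℂ) (x : ℂ), AnalyticAt ℂ (FiniteGap.potential L l δ) x → AnalyticAt ℂ f x →
          FiniteGap.oddOperator c.natDegree B f x =
            (-1) ^ c.natDegree *
              FiniteGap.operatorOf (FiniteGap.potential L l δ) c.natDegree
                (FiniteGap.xi L l δ c b d) f x := by
  have hg := generic_of hδ hδδ
  have hm := meromorphic_potential L l δ
  have hU : ∀ x, AnalyticAt ℂ (potential L l δ) x ↔ x ∈ regularSet L l δ :=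
    fun x => analyticAt_potential_iff hg heq
  obtain ⟨P, hP, hPc⟩ := PolySolution.exists_coprime (exists_polySolution (o := .inl ())
    (isOpen_regularSet hU) (fun x hx => (hU x).2 hx) (fun s x hx => analyticAt_basisFun s hx) rfl
    fun n => mem_span_basisFun hg (formalCoeff_potential_neg L l δ n)
      (fun x w hw => formalCoeff_potential_add L l δ n x hw)
      (fun x hx => analyticAt_formalCoeff ((hU x).2 hx) n)
      (fun i => poleLE_formalCoeff_half l hg (by simp) n)
      (fun j => doublePole_formalCoeff_delta hg j (heq j) n))
  -- `e n` is the coefficient of `E^n` in `Ξ`, that is `a_{g-n}` in the notation of the statement.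
  set e : ℕ → ℂ → ℂ := fun n y => ∑ s, (P s).coeff n * basisFun L l δ s y with he
  have her : ∀ n, RegularWith (potential L l δ) (e n) := fun n =>
    ⟨fun x => MeromorphicAt.fun_sum fun s _ =>
      (MeromorphicAt.const _ x).mul (meromorphic_basisFun L l δ s x),
    fun x hx => Finset.analyticAt_fun_sum _ fun s _ =>
      analyticAt_const.mul (analyticAt_basisFun s ((hU x).1 hx))⟩
  have heg : e (P (.inl ())).natDegree = fun _ => 1 := funext (hP.coeff_natDegree rfl)
  obtain ⟨B, hB, hBe⟩ := exists_oddOperator_eq hm her heg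
  have hcomm : CommutesWithSchrodinger (potential L l δ) (P (.inl ())).natDegree B :=
    commutesWithSchrodinger_of_eq her heg
      (fun x hx => hP.thirdOrder_coeff_zero ((hU x).1 hx) fun s => analyticAt_basisFun s ((hU x).1 hx))
      (fun x hx n => hP.thirdOrder_coeff_succ ((hU x).1 hx)
        (fun s => analyticAt_basisFun s ((hU x).1 hx)) n) hB hBe
  refine ⟨⟨hm, _, B, hcomm⟩, _, _, _, isXi_of_polySolution (fun x => (hU x).1) hP hPc, B, hcomm,
    fun f x hx hf => ?_⟩
  rw [hBe f x hx hf, operatorOf_eq_hierarchyOperator]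
  simp only [xi_eq_sum, coeff_sum_C_mul, he]
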